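/- Let $Q$ be a finite-dimensional smooth manifold, $\kappa$ a Riemannian metric on $Q$, $U\in C^\infty(Q)$, $L(v)=\tfrac12\kappa(v,v)-U(q)$ for $v\in T_qQ$ the associated mechanical Lagrangian, and $D\subset TQ$ a smooth regular (constant rank) distribution. Let $\kappa^\flat:TQ\to T^*Q$, $\kappa^\flat(X)(Y)=\kappa(X,Y)$, let $\mathcal M=\kappa^\flat(D)\subset T^*Q$ be the constraint manifold, a smooth vector subbundle with inclusion $\iota:\mathcal M\to T^*Q$ and projection $\tau_{\mathcal M}:\mathcal M\to Q$, and let $\mathcal H(\alpha)=\alpha(v)-L(v)$ with $v=(\kappa^\flat)^{-1}(\alpha)$ be the Hamiltonian of $L$. Let $\Theta_Q$ be the canonical 1-form on $T^*Q$, $\Omega_Q=-d\Theta_Q$, and put $\mathcal H_{\mathcal M}=\iota^*\mathcal H$, $\Theta_{\mathcal M}=\iota^*\Theta_Q$, $\Omega_{\mathcal M}=\iota^*\Omega_Q$. Let $\mathcal C_m=\{v\in T_m\mathcal M: T\tau_{\mathcal M}(v)\in D_{\tau_{\mathcal M}(m)}\}$. The nonholonomic vector field $X_{nh}$ is the unique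 section of $\mathcal C$ with $\mathbf i_{X_{nh}}\Omega_{\mathcal M}|_{\mathcal C}=d\mathcal H_{\mathcal M}|_{\mathcal C}$; a function $f$ on $\mathcal M$ is a first integral of the nonholonomic dynamics if $X_{nh}(f)=0$. Let $G$ be a Lie group with Lie algebra $\mathfrak g$ acting smoothly on $Q$ such that the tangent lift of the action leaves $L$ and $D$ invariant; then the cotangent lift of the action restricts to an action on $\mathcal M$. For $\eta\in\mathfrak g$ let $\eta_Q$, $\eta_{\mathcal M}$ be the infinitesimal generators on $Q$ and $\mathcal M$, and for a smooth map $\xi:Q\to\mathfrak g$ put $\xi_Q(q)=(\xi(q))_Q(q)$ and $\xi_{\mathcal M}(m)=(\xi(\tau_{\mathcal M}(m)))_{\mathcal M}(m)$. Let $V_q$ be the tangent space of the $G$-orbit at $q$, $S_q=D_q\cap V_q$, and let $\mathfrak g_S\subset\mathfrak g\times Q$ have fibres $(\mathfrak g_S)_q=\{\eta\in\mathfrak g:\eta_Q(q)\in S_q\}$. The nonholonomic momentum map is given by $\langle\mathcal J^{nh}(m),\eta\rangle=\Theta_{\mathcal M}(\eta_{\mathcal M})(m)$ for $\eta\in(\mathfrak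 g_S)_{\tau_{\mathcal M}(m)}$. The cotangent lift $X^{T^*Q}$ of a vector field $X$ on $Q$ is the vector field on $T^*Q$ with $\mathbf i_{X^{T^*Q}}\Omega_Q=d\tilde X$, where $\tilde X(\alpha)=\alpha(X)$. The $\mathcal M$-cotangent lift $\xi_Q^{\mathcal M}$ is the section of $\mathcal C$ whose value at $m\in\mathcal M$ is the image of $\xi_Q^{T^*Q}(m)$ under the projection $T_m(T^*Q)=\mathcal C_m\oplus\mathcal C_m^{\Omega}\to\mathcal C_m$, where $\mathcal C_m^{\Omega}$ is the $\Omega_Q$-orthogonal of $\mathcal C_m$. Let $\xi$ be a smooth section of $\mathfrak g_S$, that is, $\xi:Q\to\mathfrak g$ is smooth and $\xi_Q(q)\in S_q$ for all $q\in Q$. Then (i) $(\pounds_{\xi_{\mathcal M}}\Theta_{\mathcal M})(X_{nh})=-\,\xi_Q^{\mathcal M}(\mathcal H_{\mathcal M})$ on $\mathcal M$; (ii) the function $\langle\mathcal J^{nh},\xi\rangle$ is a first integral of the nonholonomic dynamics $X_{nh}$ if and only if $\xi_Q^{\mathcal M}(\mathcal H_{\mathcal M})=0$ on $\mathcal M$.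 -/

import Mathlib

open Bundle Set
open scoped Manifold ContDiff Topology

noncomputable section

namespace Nonholonomic

section Forms

/-! ### Differential one-forms on a manifold without boundary -/

variable {E' H N : Type*} [NormedAddCommGroup E'] [NormedSpace ℝ E'] [TopologicalSpace H]
  (J : ModelWithCorners ℝ E' H) [TopologicalSpace N] [ChartedSpace H N]

/-- The expression of the one-form `θ` in the preferred chart at `x`, i.e. its pull-back by the
inverse of the chart. -/
def oneFormInChart (θ : ∀ x : N, TangentSpace J x →L[ℝ] ℝ) (x : N) (y : E') : E' →L[ℝ] ℝ :=
  (θ ((extChartAt J x).symm y)).comp (mfderiv 𝓘(ℝ, E') J (extChartAt J x).symm y)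

/-- The exterior derivative of a one-form, computed in the preferred chart at `x`:
`dθ = (∂_i θ_j - ∂_j θ_i) dx^i ⊗ dx^j`. -/
def extDerivOneForm (θ : ∀ x : N, TangentSpace J x →L[ℝ] ℝ) (x : N)
    (v w : TangentSpace J x) : ℝ :=
  let v' : E' := mfderiv J 𝓘(ℝ, E') (extChartAt J x) x v
  let w' : E' := mfderiv J 𝓘(ℝ, E') (extChartAt J x) x w
  fderiv ℝ (oneFormInChart J θ x) (extChartAt J x x) v' w' -
    fderiv ℝ (oneFormInChart J θ x) (extChartAt J x x) w' v'

/-- The expression of the vector field `X` in the preferred chart at `x`. -/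
def vectorFieldInChart (X : ∀ x : N, TangentSpace J x) (x : N) (y : E') : E' :=
  VectorField.mpullback 𝓘(ℝ, E') J (extChartAt J x).symm X y

/-- The Lie derivative `(£_X θ)(v)` of a one-form, computed in the preferred chart at `x`:
`£_X θ = (X^i ∂_i θ_j + θ_i ∂_j X^i) dx^j`. -/
def lieDerivOneForm (X : ∀ x : N, TangentSpace J x) (θ : ∀ x : N, TangentSpace J x →L[ℝ] ℝ)
    (x : N) (v : TangentSpace J x) : ℝ :=
  let v' : E' := mfderiv J 𝓘(ℝ, E') (extChartAt J x) x v
  let y : E' := extChartAt J x x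
  fderiv ℝ (oneFormInChart J θ x) y (vectorFieldInChart J X x y) v' +
    oneFormInChart J θ x y (fderiv ℝ (vectorFieldInChart J X x) y v')

/-- The differential of a real function, as a one-form. -/
def differential (f : N → ℝ) (x : N) : TangentSpace J x →L[ℝ] ℝ :=
  mfderiv J 𝓘(ℝ, ℝ) f x

end Forms

section Cotangent

/-! ### The cotangent bundle and its canonical forms -/

/-- The cotangent space `T_q^* Q`. -/
abbrev CotangentSpace (E : Type*) [NormedAddCommGroup E] [NormedSpace ℝ E]
    {Q : Type*} [TopologicalSpace Q] [ChartedSpace E Q] (q : Q) : Type _ :=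
  TangentSpace 𝓘(ℝ, E) q →L[ℝ] Bundle.Trivial Q ℝ q

/-- The cotangent bundle `T^*Q`. -/
abbrev CotangentBundle (E : Type*) [NormedAddCommGroup E] [NormedSpace ℝ E]
    (Q : Type*) [TopologicalSpace Q] [ChartedSpace E Q] : Type _ :=
  TotalSpace (E →L[ℝ] ℝ) (fun q : Q => CotangentSpace E q)

/-- The model with corners of `T^*Q`. -/
abbrev cotangentModel (E : Type*) [NormedAddCommGroup E] [NormedSpace ℝ E] :
    ModelWithCorners ℝ (E × (E →L[ℝ] ℝ)) (ModelProd E (E →L[ℝ] ℝ)) :=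
  𝓘(ℝ, E).prod 𝓘(ℝ, E →L[ℝ] ℝ)

variable {E : Type*} [NormedAddCommGroup E] [NormedSpace ℝ E]
  {Q : Type*} [TopologicalSpace Q] [ChartedSpace E Q] [IsManifold 𝓘(ℝ, E) ∞ Q]

/-- The canonical one-form `Θ_Q` on `T^*Q`: `Θ_Q(α)(v) = α(Tτ_Q(v))`. -/
def canonicalOneForm (α : CotangentBundle E Q) : TangentSpace (cotangentModel E) α →L[ℝ] ℝ :=
  α.2.comp (mfderiv (cotangentModel E) 𝓘(ℝ, E)
    (TotalSpace.proj : CotangentBundle E Q → Q) α)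

/-- The canonical two-form `Ω_Q = -dΘ_Q` on `T^*Q`. -/
def canonicalTwoForm (α : CotangentBundle E Q) (v w : TangentSpace (cotangentModel E) α) : ℝ :=
  -extDerivOneForm (cotangentModel E) (canonicalOneForm (E := E) (Q := Q)) α v w

/-- The Hamiltonian vector field `X_f = -π_Q^♯(df)` of a function `f` on `T^*Q`: the vector field
with `i_{X_f} Ω_Q = df`. -/
def hamiltonianVectorField (f : CotangentBundle E Q → ℝ) (α : CotangentBundle E Q) :
    TangentSpace (cotangentModel E) α :=
  Classical.epsilon fun z => ∀ w, canonicalTwoForm α z w = differential (cotangentModel E) f α w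

/-- The cotangent lift `X^{T^*Q}` of a vector field `X` on `Q`: the Hamiltonian vector field of the
fibrewise linear function `α ↦ α(X)`. -/
def cotangentLift (X : ∀ q : Q, TangentSpace 𝓘(ℝ, E) q) (α : CotangentBundle E Q) :
    TangentSpace (cotangentModel E) α :=
  hamiltonianVectorField (fun β : CotangentBundle E Q => β.2 (X β.1)) α

end Cotangent

section Systems

/-! ### Nonholonomic systems -/

/-- A smooth local frame, over an open set, of a family of subspaces of the tangent spaces. -/
structure LocalFrame {E : Type*} [NormedAddCommGroup E] [NormedSpace ℝ E]
    {Q : Type*} [TopologicalSpace Q] [ChartedSpace E Q] [IsManifold 𝓘(ℝ, E) ∞ Q]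
    (D : ∀ q : Q, Submodule ℝ (TangentSpace 𝓘(ℝ, E) q)) (r : ℕ) where
  U : Set Q
  isOpen : IsOpen U
  X : Fin r → ∀ q : Q, TangentSpace 𝓘(ℝ, E) q
  smooth : ∀ i, ContMDiffOn 𝓘(ℝ, E) 𝓘(ℝ, E).tangent ∞
    (fun q => (⟨q, X i q⟩ : TangentBundle 𝓘(ℝ, E) Q)) U
  linearIndependent : ∀ q ∈ U, LinearIndependent ℝ (fun i => X i q)
  span_eq : ∀ q ∈ U, Submodule.span ℝ (range fun i => X i q) = D q

/-- A smooth regular distribution of rank `r` on `Q`. -/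
structure Distribution (E : Type*) [NormedAddCommGroup E] [NormedSpace ℝ E]
    (Q : Type*) [TopologicalSpace Q] [ChartedSpace E Q] [IsManifold 𝓘(ℝ, E) ∞ Q] (r : ℕ) where
  space : ∀ q : Q, Submodule ℝ (TangentSpace 𝓘(ℝ, E) q)
  exists_frame : ∀ q : Q, ∃ f : LocalFrame space r, q ∈ f.U

/-- A nonholonomic system `(Q, L, D)`: the Lagrangian is of mechanical type, given by a kinetic
energy metric and a potential, and `D` is a regular distribution of rank `r`. -/
structure System (E : Type*) [NormedAddCommGroup E] [NormedSpace ℝ E]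
    (Q : Type*) [TopologicalSpace Q] [ChartedSpace E Q] [IsManifold 𝓘(ℝ, E) ∞ Q] (r : ℕ) where
  metric : ContMDiffRiemannianMetric 𝓘(ℝ, E) ∞ E (fun q : Q => TangentSpace 𝓘(ℝ, E) q)
  potential : Q → ℝ
  potential_smooth : ContMDiff 𝓘(ℝ, E) 𝓘(ℝ, ℝ) ∞ potential
  D : Distribution E Q r

namespace System

variable {E : Type*} [NormedAddCommGroup E] [NormedSpace ℝ E]
  {Q : Type*} [TopologicalSpace Q] [ChartedSpace E Q] [IsManifold 𝓘(ℝ, E) ∞ Q]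
  {r : ℕ} (sys : System E Q r)

/-- The isomorphism `κ^♭ : TQ → T^*Q`, `κ^♭(X)(Y) = κ(X, Y)`. -/
def flat (q : Q) : TangentSpace 𝓘(ℝ, E) q →L[ℝ] CotangentSpace E q := sys.metric.inner q

/-- The Lagrangian `L(v) = κ(v, v) / 2 - U(q)`, for `v ∈ T_q Q`. -/
def lagrangian (v : TangentBundle 𝓘(ℝ, E) Q) : ℝ :=
  sys.metric.inner v.1 v.2 v.2 / 2 - sys.potential v.1

/-- The Hamiltonian of `L`: `H(α) = α(v) - L(v)`, where `v = (κ^♭)⁻¹(α)`. -/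
def hamiltonian (α : CotangentBundle E Q) : ℝ :=
  α.2 ((sys.flat α.1).inverse α.2) - sys.lagrangian ⟨α.1, (sys.flat α.1).inverse α.2⟩

/-! ### The constraint manifold `𝓜 = κ^♭(D)`, as a smooth vector subbundle of `T^*Q` -/

/-- The fibre `𝓜_q = κ^♭(D_q)`. -/
def constraintFiber (q : Q) : Submodule ℝ (CotangentSpace E q) :=
  (sys.D.space q).map (sys.flat q).toLinearMap

theorem flat_injective (q : Q) : Function.Injective (sys.flat q) := by
  rw [injective_iff_map_eq_zero]
  intro v hv
  by_contra h
  have h1 := sys.metric.pos q v h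
  have h2 : sys.flat q v v = 0 := by rw [hv]; rfl
  exact absurd h2 (ne_of_gt h1)

variable {sys} in
/-- The basis of `𝓜_q` that a local frame of `D` induces. -/
def frameBasis (f : LocalFrame sys.D.space r) {q : Q} (hq : q ∈ f.U) :
    Module.Basis (Fin r) ℝ (sys.constraintFiber q) :=
  ((Module.Basis.span (f.linearIndependent q hq)).map
    (LinearEquiv.ofEq _ _ (f.span_eq q hq))).map
      (Submodule.equivMapOfInjective (sys.flat q).toLinearMap (sys.flat_injective q) _)

theorem frameBasis_apply (f : LocalFrame sys.D.space r) {q : Q} (hq : q ∈ f.U) (i : Fin r) :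
    (frameBasis f hq i : CotangentSpace E q) = sys.flat q (f.X i q) := by
  have h := Module.Basis.span_apply (f.linearIndependent q hq) i
  change sys.flat q
    ((Module.Basis.span (f.linearIndependent q hq) i : TangentSpace 𝓘(ℝ, E) q)) = _
  rw [h]

open Classical in
/-- The local trivialization of `𝓜` that a local frame of `D` induces. -/
def pretrivialization (f : LocalFrame sys.D.space r) :
    Pretrivialization (Fin r → ℝ) (π (Fin r → ℝ) (fun q : Q => sys.constraintFiber q)) where
  toFun m := (m.1, if h : m.1 ∈ f.U then (frameBasis f h).equivFun m.2 else 0)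
  invFun p := ⟨p.1, if h : p.1 ∈ f.U then (frameBasis f h).equivFun.symm p.2 else 0⟩
  source := π (Fin r → ℝ) (fun q : Q => sys.constraintFiber q) ⁻¹' f.U
  target := f.U ×ˢ univ
  map_source' m hm := ⟨hm, trivial⟩
  map_target' p hp := hp.1
  left_inv' := by
    rintro ⟨q, α⟩ hq
    have hq : q ∈ f.U := hq
    simp only [dif_pos hq, LinearEquiv.symm_apply_apply]
  right_inv' := by
    rintro ⟨q, c⟩ ⟨hq, -⟩
    have hq : q ∈ f.U := hq
    simp only [dif_pos hq, LinearEquiv.apply_symm_apply]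
  open_target := f.isOpen.prod isOpen_univ
  baseSet := f.U
  open_baseSet := f.isOpen
  source_eq := rfl
  target_eq := rfl
  proj_toFun _ _ := rfl

theorem pretrivialization_apply (f : LocalFrame sys.D.space r) {q : Q} (hq : q ∈ f.U)
    (α : sys.constraintFiber q) :
    sys.pretrivialization f ⟨q, α⟩ = (q, (frameBasis f hq).equivFun α) :=
  congrArg (Prod.mk q) (dif_pos hq)

theorem pretrivialization_symm (f : LocalFrame sys.D.space r) {q : Q} (hq : q ∈ f.U)
    (c : Fin r → ℝ) :
    (sys.pretrivialization f).symm q c = (frameBasis f hq).equivFun.symm c := by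
  have h := (sys.pretrivialization f).symm_apply_apply_mk (b := q) hq
    ((frameBasis f hq).equivFun.symm c)
  rwa [pretrivialization_apply sys f hq, LinearEquiv.apply_symm_apply] at h

/-- The matrix of the scalar products of two frames, as an operator. -/
def pairing (X Y : Fin r → ∀ q : Q, TangentSpace 𝓘(ℝ, E) q) (q : Q) :
    (Fin r → ℝ) →L[ℝ] (Fin r → ℝ) :=
  ∑ i, ∑ j, sys.metric.inner q (X i q) (Y j q) •
    (ContinuousLinearMap.single ℝ (fun _ : Fin r => ℝ) j).comp (ContinuousLinearMap.proj i)

theorem pairing_equivFun (f : LocalFrame sys.D.space r) {q : Q} (hq : q ∈ f.U)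
    (Y : Fin r → ∀ q : Q, TangentSpace 𝓘(ℝ, E) q) (α : sys.constraintFiber q) :
    sys.pairing f.X Y q ((frameBasis f hq).equivFun α) =
      fun j => (α : CotangentSpace E q) (Y j q) := by
  ext j
  have h := congrArg (fun β : sys.constraintFiber q => (β : CotangentSpace E q) (Y j q))
    ((frameBasis f hq).sum_equivFun α)
  simp only [Submodule.coe_sum, Submodule.coe_smul, frameBasis_apply] at h
  rw [← h]
  simp [pairing, Finset.sum_apply, Pi.single_apply, flat, mul_comm]

theorem pairing_smooth (f g : LocalFrame sys.D.space r) :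
    ContMDiffOn 𝓘(ℝ, E) 𝓘(ℝ, (Fin r → ℝ) →L[ℝ] (Fin r → ℝ)) ∞ (sys.pairing f.X g.X)
      (f.U ∩ g.U) := by
  unfold pairing
  refine contMDiffOn_finsetSum fun i _ => contMDiffOn_finsetSum fun j _ => ?_
  have h := ContMDiffOn.clm_bundle_apply₂ (E₃ := Bundle.Trivial Q ℝ)
    (sys.metric.contMDiff.contMDiffOn (s := f.U ∩ g.U))
    ((f.smooth i).mono inter_subset_left) ((g.smooth j).mono inter_subset_right)
  have h' : ContMDiffOn 𝓘(ℝ, E) 𝓘(ℝ, ℝ) ∞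
      (fun q => sys.metric.inner q (f.X i q) (g.X j q)) (f.U ∩ g.U) :=
    fun q hq => (Bundle.contMDiffWithinAt_totalSpace.1 (h q hq)).2
  exact h'.smul contMDiffOn_const

theorem pairing_self_isInvertible (f : LocalFrame sys.D.space r) {q : Q} (hq : q ∈ f.U) :
    (sys.pairing f.X f.X q).IsInvertible := by
  have hinj : Function.Injective (sys.pairing f.X f.X q).toLinearMap := by
    rw [injective_iff_map_eq_zero]
    intro c hc
    obtain ⟨α, rfl⟩ := (frameBasis f hq).equivFun.surjective c
    have h1 : (fun j => (α : CotangentSpace E q) (f.X j q)) = 0 :=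
      (sys.pairing_equivFun f hq f.X α).symm.trans hc
    obtain ⟨α, v, hv, rfl⟩ := α
    have h2 : ∀ w ∈ sys.D.space q, sys.flat q v w = 0 := by
      intro w hw
      rw [← f.span_eq q hq] at hw
      induction hw using Submodule.span_induction with
      | mem x hx =>
        obtain ⟨j, rfl⟩ := hx
        exact congrFun h1 j
      | zero => exact map_zero _
      | add x y _ _ hx hy => exact (map_add _ x y).trans (by rw [hx, hy, add_zero])
      | smul a x _ hx => exact (map_smul _ a x).trans (by rw [hx, smul_zero])
    have h3 : v = 0 := by
      by_contra h
      exact absurd (h2 v hv) (ne_of_gt (sys.metric.pos q v h))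
    subst h3
    rw [LinearEquiv.map_eq_zero_iff]
    ext1
    exact map_zero _
  exact ⟨(LinearEquiv.ofInjectiveEndo _ hinj).toContinuousLinearEquiv, by ext1; rfl⟩

/-- The transition functions of `𝓜`. -/
def coordChange (f g : LocalFrame sys.D.space r) (q : Q) : (Fin r → ℝ) →L[ℝ] (Fin r → ℝ) :=
  (sys.pairing g.X g.X q).inverse.comp (sys.pairing f.X g.X q)

theorem coordChange_smooth (f g : LocalFrame sys.D.space r) :
    ContMDiffOn 𝓘(ℝ, E) 𝓘(ℝ, (Fin r → ℝ) →L[ℝ] (Fin r → ℝ)) ∞ (sys.coordChange f g)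
      (f.U ∩ g.U) := by
  refine ContMDiffOn.clm_comp ?_ (sys.pairing_smooth f g)
  intro q hq
  have h1 : ContDiffAt ℝ ∞ ContinuousLinearMap.inverse (sys.pairing g.X g.X q) :=
    (sys.pairing_self_isInvertible g hq.2).contDiffAt_map_inverse
  have hsub : f.U ∩ g.U ⊆ g.U ∩ g.U := fun x hx => ⟨hx.2, hx.2⟩
  have h2 := (sys.pairing_smooth g g).mono hsub
  exact h1.contMDiffAt.comp_contMDiffWithinAt q (h2 q hq)

theorem coordChange_apply (f g : LocalFrame sys.D.space r) {q : Q} (hq : q ∈ f.U ∩ g.U)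
    (c : Fin r → ℝ) :
    sys.coordChange f g q c =
      (sys.pretrivialization g ⟨q, (sys.pretrivialization f).symm q c⟩).2 := by
  rw [pretrivialization_symm sys f hq.1, pretrivialization_apply sys g hq.2]
  set α := (frameBasis f hq.1).equivFun.symm c with hα
  have hc : c = (frameBasis f hq.1).equivFun α := by simp only [hα, LinearEquiv.apply_symm_apply]
  obtain ⟨e, he⟩ := sys.pairing_self_isInvertible g hq.2
  rw [hc, coordChange, ContinuousLinearMap.comp_apply, pairing_equivFun,
    ← sys.pairing_equivFun g hq.2, ← he, ContinuousLinearMap.inverse_equiv]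
  exact e.symm_apply_apply _

/-- The atlas of `𝓜` given by all the local frames of `D`. -/
def prebundle : VectorPrebundle ℝ (Fin r → ℝ) (fun q : Q => sys.constraintFiber q) where
  pretrivializationAtlas := range sys.pretrivialization
  pretrivialization_linear' := by
    rintro _ ⟨f, rfl⟩
    refine ⟨fun q (hq : q ∈ f.U) => ?_⟩
    have : (fun α : sys.constraintFiber q => (sys.pretrivialization f ⟨q, α⟩).2) =
        fun α => (frameBasis f hq).equivFun α := by
      ext1 α
      rw [pretrivialization_apply sys f hq]
    rw [this]
    exact LinearMap.isLinear (frameBasis f hq).equivFun.toLinearMap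
  pretrivializationAt q := sys.pretrivialization (sys.D.exists_frame q).choose
  mem_base_pretrivializationAt q := (sys.D.exists_frame q).choose_spec
  pretrivialization_mem_atlas q := mem_range_self _
  exists_coordChange := by
    rintro _ ⟨f, rfl⟩ _ ⟨g, rfl⟩
    exact ⟨sys.coordChange f g, (sys.coordChange_smooth f g).continuousOn,
      fun q hq c => sys.coordChange_apply f g hq c⟩
  totalSpaceMk_isInducing q := by
    have hq := (sys.D.exists_frame q).choose_spec
    set f := (sys.D.exists_frame q).choose
    have h : sys.pretrivialization f ∘ TotalSpace.mk q =
        Prod.mk q ∘ fun α => (frameBasis f hq).equivFun α := by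
      ext1 α
      exact pretrivialization_apply sys f hq α
    rw [h]
    have hfin : FiniteDimensional ℝ (sys.constraintFiber q) :=
      (frameBasis f hq).finiteDimensional_of_finite
    let e := LinearEquiv.toContinuousLinearEquiv (𝕜 := ℝ) (E := sys.constraintFiber q)
      (F := Fin r → ℝ) (frameBasis f hq).equivFun
    exact (isInducing_prodMkRight q).comp e.toHomeomorph.isInducing

instance prebundle_isContMDiff : sys.prebundle.IsContMDiff 𝓘(ℝ, E) ∞ where
  exists_contMDiffCoordChange := by
    rintro _ ⟨f, rfl⟩ _ ⟨g, rfl⟩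
    exact ⟨sys.coordChange f g, sys.coordChange_smooth f g,
      fun q hq c => sys.coordChange_apply f g hq c⟩

/-- The constraint manifold `𝓜 = κ^♭(D)`. -/
abbrev ConstraintManifold : Type _ :=
  TotalSpace (Fin r → ℝ) (fun q : Q => sys.constraintFiber q)

/-- The model with corners of `𝓜`. -/
abbrev constraintModel (_ : System E Q r) :
    ModelWithCorners ℝ (E × (Fin r → ℝ)) (ModelProd E (Fin r → ℝ)) :=
  𝓘(ℝ, E).prod 𝓘(ℝ, Fin r → ℝ)

instance : TopologicalSpace sys.ConstraintManifold := sys.prebundle.totalSpaceTopology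

instance : FiberBundle (Fin r → ℝ) (fun q : Q => sys.constraintFiber q) :=
  sys.prebundle.toFiberBundle

instance : VectorBundle ℝ (Fin r → ℝ) (fun q : Q => sys.constraintFiber q) :=
  sys.prebundle.toVectorBundle

instance : ContMDiffVectorBundle ∞ (Fin r → ℝ) (fun q : Q => sys.constraintFiber q) 𝓘(ℝ, E) :=
  sys.prebundle.contMDiffVectorBundle 𝓘(ℝ, E)

/-- The projection `τ_𝓜 : 𝓜 → Q`. -/
def proj (m : sys.ConstraintManifold) : Q := m.1

/-- The inclusion `ι : 𝓜 → T^*Q`. -/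
def incl (m : sys.ConstraintManifold) : CotangentBundle E Q := ⟨m.1, m.2.1⟩

/-- The derivative of the inclusion `ι`. -/
def inclDeriv (m : sys.ConstraintManifold) :
    TangentSpace sys.constraintModel m →L[ℝ] TangentSpace (cotangentModel E) (sys.incl m) :=
  mfderiv sys.constraintModel (cotangentModel E) sys.incl m

/-- `H_𝓜 = ι^* H`. -/
def hamiltonianM (m : sys.ConstraintManifold) : ℝ := sys.hamiltonian (sys.incl m)

/-- `Θ_𝓜 = ι^* Θ_Q`. -/
def oneFormM (m : sys.ConstraintManifold) : TangentSpace sys.constraintModel m →L[ℝ] ℝ :=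
  (canonicalOneForm (sys.incl m)).comp (sys.inclDeriv m)

/-- `Ω_𝓜 = ι^* Ω_Q`. -/
def twoFormM (m : sys.ConstraintManifold) (v w : TangentSpace sys.constraintModel m) : ℝ :=
  canonicalTwoForm (sys.incl m) (sys.inclDeriv m v) (sys.inclDeriv m w)

/-- The distribution `𝓒` on `𝓜`: `𝓒_m = {v ∈ T_m 𝓜 : Tτ_𝓜(v) ∈ D}`. -/
def C (m : sys.ConstraintManifold) : Submodule ℝ (TangentSpace sys.constraintModel m) :=
  (sys.D.space (sys.proj m)).comap
    (mfderiv sys.constraintModel 𝓘(ℝ, E) sys.proj m).toLinearMap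

/-- The nonholonomic vector field `X_nh`: the section of `𝓒` with
`i_{X_nh} Ω_𝓜 |_𝓒 = dH_𝓜 |_𝓒`. -/
def Xnh (m : sys.ConstraintManifold) : TangentSpace sys.constraintModel m :=
  Classical.epsilon fun v => v ∈ sys.C m ∧
    ∀ w ∈ sys.C m, sys.twoFormM m v w = differential sys.constraintModel sys.hamiltonianM m w

/-- A function `f` on `𝓜` is a first integral of the nonholonomic dynamics if `X_nh(f) = 0`. -/
def IsFirstIntegral (f : sys.ConstraintManifold → ℝ) : Prop :=
  ∀ m, differential sys.constraintModel f m (sys.Xnh m) = 0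

/-- The projection `T_m(T^*Q) → 𝓒_m` along the symplectic orthogonal of `𝓒_m`, for the
decomposition `T_m(T^*Q) = 𝓒_m ⊕ 𝓒_m^Ω`. -/
def projC (m : sys.ConstraintManifold) (z : TangentSpace (cotangentModel E) (sys.incl m)) :
    TangentSpace sys.constraintModel m :=
  Classical.epsilon fun v => v ∈ sys.C m ∧
    ∀ w ∈ sys.C m, canonicalTwoForm (sys.incl m) (z - sys.inclDeriv m v) (sys.inclDeriv m w) = 0

/-- The `𝓜`-cotangent lift `X^𝓜` of a vector field `X` on `Q`. -/
def liftM (X : ∀ q : Q, TangentSpace 𝓘(ℝ, E) q) (m : sys.ConstraintManifold) :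
    TangentSpace sys.constraintModel m :=
  sys.projC m (cotangentLift X (sys.incl m))

end System

end Systems

section Symmetries

/-! ### Symmetries -/

variable {E : Type*} [NormedAddCommGroup E] [NormedSpace ℝ E]
  {Q : Type*} [TopologicalSpace Q] [ChartedSpace E Q] [IsManifold 𝓘(ℝ, E) ∞ Q]
  {r : ℕ} (sys : System E Q r)
  (EG : Type*) [NormedAddCommGroup EG] [NormedSpace ℝ EG]
  {G : Type*} [TopologicalSpace G] [ChartedSpace EG G] [Group G] [MulAction G Q]

variable (E) in
/-- The tangent lift `T_q Q → T_{gq} Q` of the action of `g`. -/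
def tangentAction (g : G) (q : Q) : TangentSpace 𝓘(ℝ, E) q →L[ℝ] TangentSpace 𝓘(ℝ, E) (g • q) :=
  mfderiv 𝓘(ℝ, E) 𝓘(ℝ, E) (fun x : Q => g • x) q

variable (E) in
/-- The infinitesimal generators of the action at `q`: `η ↦ η_Q(q)`. -/
def generatorQ (q : Q) : GroupLieAlgebra 𝓘(ℝ, EG) G →L[ℝ] TangentSpace 𝓘(ℝ, E) q :=
  mfderiv 𝓘(ℝ, EG) 𝓘(ℝ, E) (fun g : G => g • q) 1

variable (G) in
/-- The action of `G` is a symmetry of `(Q, L, D)`: its tangent lift leaves `L` and `D`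
invariant. -/
structure System.IsSymmetry : Prop where
  lagrangian_eq : ∀ (g : G) (q : Q) (v : TangentSpace 𝓘(ℝ, E) q),
    sys.lagrangian ⟨g • q, tangentAction E g q v⟩ = sys.lagrangian ⟨q, v⟩
  map_space_eq : ∀ (g : G) (q : Q),
    (sys.D.space q).map (tangentAction E g q).toLinearMap = sys.D.space (g • q)

variable {sys}

set_option linter.unusedSectionVars false in
theorem System.IsSymmetry.inner_eq (h : sys.IsSymmetry G) (g : G) (q : Q)
    (v w : TangentSpace 𝓘(ℝ, E) q) :
    sys.metric.inner (g • q) (tangentAction E g q v) (tangentAction E g q w) =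
      sys.metric.inner q v w := by
  have h0 := h.lagrangian_eq g q 0
  have h1 := h.lagrangian_eq g q v
  have h2 := h.lagrangian_eq g q w
  have h3 := h.lagrangian_eq g q (v + w)
  have s1 := sys.metric.symm q v w
  have s2 := sys.metric.symm (g • q) (tangentAction E g q v) (tangentAction E g q w)
  simp only [System.lagrangian, map_zero, map_add, add_apply] at h0 h1 h2 h3
  linarith

set_option linter.unusedSectionVars false in
theorem tangentAction_isInvertible [ContMDiffSMul 𝓘(ℝ, EG) 𝓘(ℝ, E) ∞ G Q] (g : G) (q : Q) :
    (tangentAction E g q).IsInvertible :=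
  ⟨(Diffeomorph.smul 𝓘(ℝ, EG) 𝓘(ℝ, E) ∞ g).mfderivToContinuousLinearEquiv (by simp) q, rfl⟩

/-- The cotangent lift of the action: `g · α = α ∘ (T_q φ_g)⁻¹`, for `α ∈ T_q^* Q`. -/
def cotangentAction (g : G) (α : CotangentBundle E Q) : CotangentBundle E Q :=
  ⟨g • α.1, α.2.comp (tangentAction E g α.1).inverse⟩

/-- The lifted action leaves `𝓜` invariant. -/
theorem System.IsSymmetry.cotangentAction_mem [ContMDiffSMul 𝓘(ℝ, EG) 𝓘(ℝ, E) ∞ G Q]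
    (h : sys.IsSymmetry G) (g : G) (m : sys.ConstraintManifold) :
    (cotangentAction g (sys.incl m)).2 ∈ sys.constraintFiber (g • m.1) := by
  obtain ⟨q, α, v, hv, rfl⟩ := m
  refine ⟨tangentAction E g q v, ?_, ?_⟩
  · rw [← h.map_space_eq g q]
    exact ⟨v, hv, rfl⟩
  · obtain ⟨e, he⟩ := tangentAction_isInvertible (E := E) EG g q
    ext w
    obtain ⟨u, rfl⟩ : ∃ u, tangentAction E g q u = w := ⟨e.symm w, by rw [← he]; simp⟩
    refine (h.inner_eq g q v u).trans ?_
    have : (tangentAction E g q).inverse (tangentAction E g q u) = u := by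
      rw [← he, ContinuousLinearMap.inverse_equiv]
      exact e.symm_apply_apply u
    exact congrArg (sys.flat q v) this.symm

/-- The action of `G` on `𝓜`, the restriction of the lifted action on `T^*Q`. -/
def constraintAction [ContMDiffSMul 𝓘(ℝ, EG) 𝓘(ℝ, E) ∞ G Q] (h : sys.IsSymmetry G)
    (g : G) (m : sys.ConstraintManifold) : sys.ConstraintManifold :=
  ⟨g • m.1, ⟨(cotangentAction g (sys.incl m)).2, h.cotangentAction_mem EG g m⟩⟩

/-- The infinitesimal generators of the action on `𝓜` at `m`: `η ↦ η_𝓜(m)`. -/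
def generatorM [ContMDiffSMul 𝓘(ℝ, EG) 𝓘(ℝ, E) ∞ G Q] (h : sys.IsSymmetry G)
    (m : sys.ConstraintManifold) :
    GroupLieAlgebra 𝓘(ℝ, EG) G →L[ℝ] TangentSpace sys.constraintModel m :=
  mfderiv 𝓘(ℝ, EG) sys.constraintModel (fun g : G => constraintAction EG h g m) 1

variable (E G) in
/-- The vertical space `V_q`, the tangent space of the `G`-orbit at `q`. -/
def verticalSpace (q : Q) : Submodule ℝ (TangentSpace 𝓘(ℝ, E) q) :=
  (generatorQ E EG (G := G) q).range

variable (sys G) in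
/-- The intersection `S_q = D_q ∩ V_q`. -/
def spaceS (q : Q) : Submodule ℝ (TangentSpace 𝓘(ℝ, E) q) :=
  sys.D.space q ⊓ verticalSpace E EG G q

variable (sys G) in
/-- The fibre of `𝔤_S` at `q`: the `η ∈ 𝔤` with `η_Q(q) ∈ S_q`. -/
def gS (q : Q) : Submodule ℝ (GroupLieAlgebra 𝓘(ℝ, EG) G) :=
  (spaceS sys EG G q).comap (generatorQ E EG q).toLinearMap

variable (sys G) in
/-- The smooth sections of `𝔤_S → Q`, as maps `ξ : Q → 𝔤`. -/
structure SectionGS where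
  toFun : Q → GroupLieAlgebra 𝓘(ℝ, EG) G
  smooth : ContMDiff (M' := EG) 𝓘(ℝ, E) 𝓘(ℝ, EG) ∞ toFun
  mem : ∀ q, toFun q ∈ gS sys EG G q

namespace SectionGS

variable {EG} (ξ : SectionGS sys EG G)

/-- The vector field `ξ_Q` on `Q`: `ξ_Q(q) = (ξ_q)_Q(q)`. -/
def onQ (q : Q) : TangentSpace 𝓘(ℝ, E) q := generatorQ E EG q (ξ.toFun q)

/-- The vector field `ξ_𝓜` on `𝓜`: `ξ_𝓜(m) = (ξ_q)_𝓜(m)` with `q = τ_𝓜(m)`. -/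
def onM [ContMDiffSMul 𝓘(ℝ, EG) 𝓘(ℝ, E) ∞ G Q] (h : sys.IsSymmetry G)
    (m : sys.ConstraintManifold) : TangentSpace sys.constraintModel m :=
  generatorM EG h m (ξ.toFun (sys.proj m))

end SectionGS

/-- The nonholonomic momentum map `J^nh : 𝓜 → 𝔤_S^*`: `⟨J^nh(m), η⟩ = Θ_𝓜(m)(η_𝓜(m))`. -/
def momentumMap [ContMDiffSMul 𝓘(ℝ, EG) 𝓘(ℝ, E) ∞ G Q] (h : sys.IsSymmetry G)
    (m : sys.ConstraintManifold) : Module.Dual ℝ (gS sys EG G (sys.proj m)) :=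
  ((sys.oneFormM m).comp (generatorM EG h m)).toLinearMap.domRestrict (gS sys EG G (sys.proj m))

/-- The function `⟨J^nh, ξ⟩` on `𝓜`. -/
def SectionGS.momentum {EG : Type*} [NormedAddCommGroup EG] [NormedSpace ℝ EG]
    [ChartedSpace EG G] [ContMDiffSMul 𝓘(ℝ, EG) 𝓘(ℝ, E) ∞ G Q]
    (ξ : SectionGS sys EG G) (h : sys.IsSymmetry G) (m : sys.ConstraintManifold) : ℝ :=
  momentumMap EG h m ⟨ξ.toFun (sys.proj m), ξ.mem (sys.proj m)⟩

end Symmetries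

end Nonholonomic

end

noncomputable section

namespace Nonholonomic

/-! Write J_ξ = ⟨J^nh, ξ⟩ = Θ_𝓜(ξ_𝓜). Both claims come from two expressions for X_nh(J_ξ).

Cartan's formula gives (£_{ξ_𝓜} Θ_𝓜)(X_nh) = dΘ_𝓜(ξ_𝓜, X_nh) + X_nh(J_ξ). The first term on the
right is Ω_𝓜(X_nh, ξ_𝓜). Since ξ is a section of 𝔤_S, ξ_𝓜 lies in 𝓒, so this term equals dH_𝓜(ξ_𝓜).
It vanishes because H_𝓜 is G-invariant and ξ_𝓜(m) is, at each m, the generator of a single Lie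
algebra element. Hence the Lie derivative is X_nh(J_ξ): `SectionGS.lieDerivOneForm_Xnh`.

On the other hand J_ξ is the pull-back by ι of α ↦ α(ξ_Q), so X_nh(J_ξ) = Ω_Q(ξ_Q^{T^*Q}, Tι X_nh).
As X_nh lies in 𝓒, only the 𝓒-component ξ_Q^𝓜 of the cotangent lift contributes, and antisymmetry
together with the equation of X_nh turns this into -dH_𝓜(ξ_Q^𝓜):
`SectionGS.differential_momentum_Xnh`.

The remaining work justifies these manipulations. X_nh, the projection to 𝓒 and Hamiltonian vector
fields are choices, so their equations hold only once a solution exists; this is nondegeneracy of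
Ω_Q, and of Ω_𝓜 on 𝓒 (`System.twoFormM_nondegenerate`), the latter by positivity of κ.
Differentiability on 𝓜 is obtained by replacing a covector by its velocity in D
(`System.velocity_contMDiff`, `System.contMDiffAt_of_velocity`). The forms are computed in bundle
charts, where they take their Darboux shape (`extDerivOneForm_pullback`, `canonicalTwoForm_apply`).
-/

theorem isInvertible_of_injective {E : Type*} [NormedAddCommGroup E] [NormedSpace ℝ E]
    [FiniteDimensional ℝ E] (L : E →L[ℝ] E →L[ℝ] ℝ) (hL : Function.Injective L) :
    L.IsInvertible := by
  have hs : Function.Surjective L.toLinearMap := by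
    refine (LinearMap.injective_iff_surjective_of_finrank_eq_finrank (f := L.toLinearMap) ?_).1 hL
    rw [← (LinearMap.toContinuousLinearMap (𝕜 := ℝ) (E := E) (F' := ℝ)).finrank_eq]
    exact Subspace.dual_finrank_eq.symm
  exact ⟨(LinearEquiv.ofBijective L.toLinearMap ⟨hL, hs⟩).toContinuousLinearEquiv, by ext1; rfl⟩

/-! ### Smoothness in vector bundles and on the constraint manifold -/

section Bundles

variable {B F M EB HB EM HM : Type*} {n : WithTop ℕ∞}
  {V : B → Type*} [∀ x, AddCommGroup (V x)] [∀ x, Module ℝ (V x)]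
  [NormedAddCommGroup F] [NormedSpace ℝ F]
  [TopologicalSpace (TotalSpace F V)] [∀ x, TopologicalSpace (V x)]
  [NormedAddCommGroup EB] [NormedSpace ℝ EB] [TopologicalSpace HB]
  {IB : ModelWithCorners ℝ EB HB} [TopologicalSpace B] [ChartedSpace HB B]
  [NormedAddCommGroup EM] [NormedSpace ℝ EM] [TopologicalSpace HM]
  {IM : ModelWithCorners ℝ EM HM} [TopologicalSpace M] [ChartedSpace HM M]
  [FiberBundle F V] [VectorBundle ℝ F V]

/-- A linear combination with smooth coefficients of smooth maps to a vector bundle over the same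
base map is smooth. -/
theorem contMDiffAt_sum_smul {ι : Type*} [Fintype ι] {b : M → B} {x₀ : M} {c : ι → M → ℝ}
    {v : ι → ∀ x, V (b x)} (hb : ContMDiffAt IM IB n b x₀)
    (hc : ∀ i, ContMDiffAt IM 𝓘(ℝ, ℝ) n (c i) x₀)
    (hv : ∀ i, ContMDiffAt IM (IB.prod 𝓘(ℝ, F)) n (fun x => TotalSpace.mk' F (b x) (v i x)) x₀) :
    ContMDiffAt IM (IB.prod 𝓘(ℝ, F)) n
      (fun x => TotalSpace.mk' F (b x) (∑ i, c i x • v i x)) x₀ := by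
  rw [contMDiffAt_totalSpace]
  refine ⟨hb, ?_⟩
  have h : ContMDiffAt IM 𝓘(ℝ, F) n
      (fun x => ∑ i, c i x • (trivializationAt F V (b x₀) ⟨b x, v i x⟩).2) x₀ := by
    refine contMDiffAt_finsetSum fun i _ => (hc i).smul ?_
    exact (contMDiffAt_totalSpace.1 (hv i)).2
  refine h.congr_of_eventuallyEq ?_
  filter_upwards [hb.continuousAt.preimage_mem_nhds
    ((trivializationAt F V (b x₀)).open_baseSet.mem_nhds
      (FiberBundle.mem_baseSet_trivializationAt' (b x₀)))] with x hx
  have hL : ∀ w : V (b x), (trivializationAt F V (b x₀) ⟨b x, w⟩).2 =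
      (trivializationAt F V (b x₀)).linearMapAt ℝ (b x) w := fun w => by
    rw [(trivializationAt F V (b x₀)).coe_linearMapAt_of_mem hx]
  simp only [hL, map_sum, map_smul]

end Bundles

namespace System

variable {E : Type*} [NormedAddCommGroup E] [NormedSpace ℝ E]
  {Q : Type*} [TopologicalSpace Q] [ChartedSpace E Q] [IsManifold 𝓘(ℝ, E) ∞ Q]
  {r : ℕ} (sys : System E Q r)

/-- The preferred local frame of `D` around `q`. -/
def frameAt (q : Q) : LocalFrame sys.D.space r := (sys.D.exists_frame q).choose

theorem mem_frameAt (q : Q) : q ∈ (sys.frameAt q).U := (sys.D.exists_frame q).choose_spec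

theorem trivializationAt_apply (q : Q) (m : sys.ConstraintManifold) :
    trivializationAt (Fin r → ℝ) (fun q : Q => sys.constraintFiber q) q m =
      sys.pretrivialization (sys.frameAt q) m := rfl

theorem metric_contMDiffAt {EN HN N : Type*} [NormedAddCommGroup EN] [NormedSpace ℝ EN]
    [TopologicalSpace HN] {IN : ModelWithCorners ℝ EN HN} [TopologicalSpace N] [ChartedSpace HN N]
    {b : N → Q} {v w : ∀ x, TangentSpace 𝓘(ℝ, E) (b x)} {x₀ : N}
    (hv : ContMDiffAt IN 𝓘(ℝ, E).tangent ∞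
      (fun x => (⟨b x, v x⟩ : TangentBundle 𝓘(ℝ, E) Q)) x₀)
    (hw : ContMDiffAt IN 𝓘(ℝ, E).tangent ∞
      (fun x => (⟨b x, w x⟩ : TangentBundle 𝓘(ℝ, E) Q)) x₀) :
    ContMDiffAt IN 𝓘(ℝ, ℝ) ∞ (fun x => sys.metric.inner (b x) (v x) (w x)) x₀ := by
  have hb : ContMDiffAt IN 𝓘(ℝ, E) ∞ b x₀ := (contMDiffAt_totalSpace.1 hv).1
  have h := ContMDiffAt.clm_bundle_apply₂ (E₃ := Bundle.Trivial Q ℝ)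
    ((sys.metric.contMDiff (b x₀)).comp x₀ hb) hv hw
  exact (contMDiffAt_totalSpace.1 h).2

/-- The velocity `(κ^♭)⁻¹(m) ∈ D` of a point `m` of `𝓜`. -/
def velocity (m : sys.ConstraintManifold) : TangentSpace 𝓘(ℝ, E) m.1 := m.2.2.choose

theorem flat_velocity (m : sys.ConstraintManifold) :
    sys.flat m.1 (sys.velocity m) = (m.2 : CotangentSpace E m.1) :=
  m.2.2.choose_spec.2

theorem velocity_eq_sum (f : LocalFrame sys.D.space r) {m : sys.ConstraintManifold}
    (hm : m.1 ∈ f.U) :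
    sys.velocity m = ∑ i, (frameBasis f hm).equivFun m.2 i • f.X i m.1 := by
  apply sys.flat_injective m.1
  rw [flat_velocity]
  conv_lhs => rw [← (frameBasis f hm).sum_equivFun m.2]
  simp only [Submodule.coe_sum, Submodule.coe_smul, frameBasis_apply, map_sum, map_smul]

/-- The fibre coordinates of m in the chart of 𝓜 are exactly the coefficients of the velocity in the
local frame of D. -/
theorem velocity_contMDiff :
    ContMDiff sys.constraintModel 𝓘(ℝ, E).tangent ∞
      (fun m : sys.ConstraintManifold => (⟨m.1, sys.velocity m⟩ : TangentBundle 𝓘(ℝ, E) Q)) := by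
  intro m₀
  let f := sys.frameAt m₀.1
  have hb : ContMDiffAt sys.constraintModel 𝓘(ℝ, E) ∞
      (fun m : sys.ConstraintManifold => m.1) m₀ := contMDiffAt_proj _
  have hf : ∀ᶠ m : sys.ConstraintManifold in 𝓝 m₀, m.1 ∈ f.U :=
    hb.continuousAt.preimage_mem_nhds (f.isOpen.mem_nhds (sys.mem_frameAt m₀.1))
  -- Smoothness of the identity of 𝓜, read in the trivialization, is smoothness of the fibre
  -- coordinates.
  have hid : ContMDiffAt sys.constraintModel sys.constraintModel ∞
      (fun m : sys.ConstraintManifold => m) m₀ := contMDiffAt_id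
  have hc := (contMDiffAt_totalSpace.1 hid).2
  have key := contMDiffAt_sum_smul (F := E) (V := fun q : Q => TangentSpace 𝓘(ℝ, E) q)
    (c := fun i (m : sys.ConstraintManifold) =>
      (trivializationAt (Fin r → ℝ) (fun q : Q => sys.constraintFiber q) m₀.1 m).2 i)
    (v := fun i (m : sys.ConstraintManifold) => f.X i m.1) hb
    (fun i => contMDiffAt_pi_space.1 hc i)
    (fun i => (((f.smooth i) m₀.1 (sys.mem_frameAt m₀.1)).contMDiffAt
      (f.isOpen.mem_nhds (sys.mem_frameAt m₀.1))).comp m₀ hb)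
  refine key.congr_of_eventuallyEq ?_
  filter_upwards [hf] with m hm
  have h : (trivializationAt (Fin r → ℝ) (fun q : Q => sys.constraintFiber q) m₀.1 m).2 =
      (frameBasis f hm).equivFun m.2 := congrArg Prod.snd (sys.pretrivialization_apply f hm m.2)
  rw [sys.velocity_eq_sum f hm, h]

/-- The inclusion is κ^♭ applied to the velocity, and both are smooth. -/
theorem incl_contMDiff :
    ContMDiff sys.constraintModel (cotangentModel E) ∞ sys.incl := by
  have h := ContMDiff.clm_bundle_apply (E₂ := fun q : Q => CotangentSpace E q)
    (sys.metric.contMDiff.comp (contMDiff_proj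
      (fun q : Q => sys.constraintFiber q) (n := ∞) (IB := 𝓘(ℝ, E)) (F := Fin r → ℝ)))
      sys.velocity_contMDiff
  convert h using 2 with m
  exact congrArg (TotalSpace.mk m.1) (sys.flat_velocity m).symm

/-- Ensures that the `inverse` in the definition of the Hamiltonian is the true inverse of κ^♭ and
not the default value zero. -/
theorem flat_isInvertible [FiniteDimensional ℝ E] (q : Q) : (sys.flat q).IsInvertible :=
  isInvertible_of_injective (E := E) (sys.flat q) (sys.flat_injective q)

theorem hamiltonianM_eq [FiniteDimensional ℝ E] (m : sys.ConstraintManifold) :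
    sys.hamiltonianM m =
      sys.metric.inner m.1 (sys.velocity m) (sys.velocity m) / 2 + sys.potential m.1 := by
  obtain ⟨e, he⟩ := sys.flat_isInvertible m.1
  have h : (sys.flat m.1).inverse (m.2 : CotangentSpace E m.1) = sys.velocity m := by
    rw [← sys.flat_velocity m, ← he, ContinuousLinearMap.inverse_equiv]
    exact e.symm_apply_apply _
  have h1 : sys.hamiltonianM m = (m.2 : CotangentSpace E m.1)
      ((sys.flat m.1).inverse (m.2 : CotangentSpace E m.1)) -
      sys.lagrangian ⟨m.1, (sys.flat m.1).inverse (m.2 : CotangentSpace E m.1)⟩ := rfl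
  have h2 : (m.2 : CotangentSpace E m.1) (sys.velocity m) =
      sys.metric.inner m.1 (sys.velocity m) (sys.velocity m) := by
    rw [← sys.flat_velocity m]; rfl
  rw [h1, h, h2, lagrangian]
  ring

theorem hamiltonianM_contMDiff [FiniteDimensional ℝ E] :
    ContMDiff sys.constraintModel 𝓘(ℝ, ℝ) ∞ sys.hamiltonianM := by
  intro m
  have h1 := sys.metric_contMDiffAt (sys.velocity_contMDiff m) (sys.velocity_contMDiff m)
  have h2 := (sys.potential_smooth m.1).comp m
    (contMDiffAt_proj (fun q : Q => sys.constraintFiber q) (F := Fin r → ℝ) (p := m))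
  have h3 := (h1.mul (contMDiffAt_const (c := (1 / 2 : ℝ)))).add h2
  refine h3.congr_of_eventuallyEq (.of_forall fun m => ?_)
  rw [hamiltonianM_eq]
  simp [div_eq_mul_inv]

/-- A map to `𝓜` is smooth as soon as its base map and its velocity are. -/
theorem contMDiffAt_of_velocity {EN HN N : Type*} [NormedAddCommGroup EN] [NormedSpace ℝ EN]
    [TopologicalSpace HN] {IN : ModelWithCorners ℝ EN HN} [TopologicalSpace N] [ChartedSpace HN N]
    {F : N → sys.ConstraintManifold} {x₀ : N}
    (hF : ContMDiffAt IN 𝓘(ℝ, E).tangent ∞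
      (fun x => (⟨(F x).1, sys.velocity (F x)⟩ : TangentBundle 𝓘(ℝ, E) Q)) x₀) :
    ContMDiffAt IN sys.constraintModel ∞ F x₀ := by
  have hb : ContMDiffAt IN 𝓘(ℝ, E) ∞ (fun x => (F x).1) x₀ := (contMDiffAt_totalSpace.1 hF).1
  rw [contMDiffAt_totalSpace]
  refine ⟨hb, ?_⟩
  let f := sys.frameAt (F x₀).1
  have hx₀ : (F x₀).1 ∈ f.U := sys.mem_frameAt _
  have hf : ∀ᶠ x in 𝓝 x₀, (F x).1 ∈ f.U :=
    hb.continuousAt.preimage_mem_nhds (f.isOpen.mem_nhds hx₀)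
  have hX : ∀ j, ContMDiffAt IN 𝓘(ℝ, E).tangent ∞
      (fun x => (⟨(F x).1, f.X j (F x).1⟩ : TangentBundle 𝓘(ℝ, E) Q)) x₀ := fun j =>
    (((f.smooth j) _ hx₀).contMDiffAt (f.isOpen.mem_nhds hx₀)).comp x₀ hb
  -- The frame coefficients of the velocity are the inverse Gram matrix applied to its scalar
  -- products with the frame; both depend smoothly on x.
  have hp : ContMDiffAt IN 𝓘(ℝ, Fin r → ℝ) ∞
      (fun x j => sys.metric.inner (F x).1 (sys.velocity (F x)) (f.X j (F x).1)) x₀ :=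
    contMDiffAt_pi_space.2 fun j => sys.metric_contMDiffAt hF (hX j)
  have hinv : ContMDiffAt IN 𝓘(ℝ, (Fin r → ℝ) →L[ℝ] (Fin r → ℝ)) ∞
      (fun x => (sys.pairing f.X f.X (F x).1).inverse) x₀ := by
    have h1 : ContDiffAt ℝ ∞ ContinuousLinearMap.inverse (sys.pairing f.X f.X (F x₀).1) :=
      (sys.pairing_self_isInvertible f hx₀).contDiffAt_map_inverse
    have h2 := ((sys.pairing_smooth f f) _ ⟨hx₀, hx₀⟩).contMDiffAt
      ((f.isOpen.inter f.isOpen).mem_nhds ⟨hx₀, hx₀⟩)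
    exact (h1.contMDiffAt.comp (F x₀).1 h2).comp x₀ hb
  refine (hinv.clm_apply hp).congr_of_eventuallyEq ?_
  filter_upwards [hf] with x hx
  rw [trivializationAt_apply, show F x = ⟨(F x).1, (F x).2⟩ from rfl,
    sys.pretrivialization_apply f hx]
  obtain ⟨e, he⟩ := sys.pairing_self_isInvertible f hx
  have h := sys.pairing_equivFun f hx f.X (F x).2
  have h' : (fun j => sys.metric.inner (F x).1 (sys.velocity (F x)) (f.X j (F x).1)) =
      e ((frameBasis f hx).equivFun (F x).2) := by
    have : e ((frameBasis f hx).equivFun (F x).2) =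
        sys.pairing f.X f.X (F x).1 ((frameBasis f hx).equivFun (F x).2) := by rw [← he]; rfl
    rw [this, h]
    ext j
    rw [← sys.flat_velocity (F x)]
    rfl
  rw [← he, ContinuousLinearMap.inverse_equiv]
  exact ((congrArg e.symm h').trans (e.symm_apply_apply _)).symm

end System

/-! ### Partial derivatives as smooth maps to the tangent bundle -/

section PartialDerivatives

variable {EA HA A EN HN N EP HP P ES HS S : Type*}
  [NormedAddCommGroup EA] [NormedSpace ℝ EA] [TopologicalSpace HA] {IA : ModelWithCorners ℝ EA HA}
  [TopologicalSpace A] [ChartedSpace HA A] [IsManifold IA ∞ A]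
  [NormedAddCommGroup EN] [NormedSpace ℝ EN] [TopologicalSpace HN] {IN : ModelWithCorners ℝ EN HN}
  [TopologicalSpace N] [ChartedSpace HN N] [IsManifold IN ∞ N]
  [NormedAddCommGroup EP] [NormedSpace ℝ EP] [TopologicalSpace HP] {IP : ModelWithCorners ℝ EP HP}
  [TopologicalSpace P] [ChartedSpace HP P] [IsManifold IP ∞ P]
  [NormedAddCommGroup ES] [NormedSpace ℝ ES] [TopologicalSpace HS] {IS : ModelWithCorners ℝ ES HS}
  [TopologicalSpace S] [ChartedSpace HS S]

/-- Under the identification of TA × TN with T(A × N), the tangent map of Φ is the sum of its two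
partial derivatives. -/
theorem contMDiff_tangentMap_prod {Φ : A × N → P} (hΦ : ContMDiff (IA.prod IN) IP ∞ Φ)
    {a : S → A} {v : ∀ s, TangentSpace IA (a s)} {b : S → N} {w : ∀ s, TangentSpace IN (b s)}
    (hv : ContMDiff IS IA.tangent ∞ (fun s => (⟨a s, v s⟩ : TangentBundle IA A)))
    (hw : ContMDiff IS IN.tangent ∞ (fun s => (⟨b s, w s⟩ : TangentBundle IN N))) :
    ContMDiff IS IP.tangent ∞ (fun s => (⟨Φ (a s, b s),
      mfderiv IA IP (fun x => Φ (x, b s)) (a s) (v s) +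
        mfderiv IN IP (fun y => Φ (a s, y)) (b s) (w s)⟩ : TangentBundle IP P)) := by
  have h1 : ContMDiff (IA.prod IN).tangent IP.tangent ∞ (tangentMap (IA.prod IN) IP Φ) :=
    ContMDiff.contMDiff_tangentMap hΦ (m := ∞) (by simp)
  have h2 : ContMDiff (IA.tangent.prod IN.tangent) (IA.prod IN).tangent ∞
      (equivTangentBundleProd IA A IN N).symm := contMDiff_equivTangentBundleProd_symm
  have h3 := (h1.comp h2).comp (hv.prodMk hw)
  convert h3 using 2 with s
  refine congrArg (TotalSpace.mk _) ?_
  have hd : MDifferentiableAt (IA.prod IN) IP Φ (a s, b s) := hΦ.mdifferentiableAt (by simp)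
  have key := mfderiv_prod_eq_add_apply (v := ((v s, w s) : EA × EN)) hd
  exact key.symm

theorem contMDiff_mfderiv_left {Φ : A × N → P} (hΦ : ContMDiff (IA.prod IN) IP ∞ Φ)
    {a : S → A} {v : ∀ s, TangentSpace IA (a s)} {b : S → N}
    (hv : ContMDiff IS IA.tangent ∞ (fun s => (⟨a s, v s⟩ : TangentBundle IA A)))
    (hb : ContMDiff IS IN ∞ b) :
    ContMDiff IS IP.tangent ∞ (fun s => (⟨Φ (a s, b s),
      mfderiv IA IP (fun x => Φ (x, b s)) (a s) (v s)⟩ : TangentBundle IP P)) := by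
  have h := contMDiff_tangentMap_prod hΦ hv
    ((contMDiff_zeroSection ℝ (TangentSpace IN : N → Type _) (n := ∞)).comp hb)
  convert h using 2 with s
  refine congrArg (TotalSpace.mk _) ?_
  simp

theorem contMDiff_mfderiv_right {Φ : A × N → P} (hΦ : ContMDiff (IA.prod IN) IP ∞ Φ)
    {a : S → A} {b : S → N} {w : ∀ s, TangentSpace IN (b s)}
    (ha : ContMDiff IS IA ∞ a)
    (hw : ContMDiff IS IN.tangent ∞ (fun s => (⟨b s, w s⟩ : TangentBundle IN N))) :
    ContMDiff IS IP.tangent ∞ (fun s => (⟨Φ (a s, b s),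
      mfderiv IN IP (fun y => Φ (a s, y)) (b s) (w s)⟩ : TangentBundle IP P)) := by
  have h := contMDiff_tangentMap_prod hΦ
    ((contMDiff_zeroSection ℝ (TangentSpace IA : A → Type _) (n := ∞)).comp ha) hw
  convert h using 2 with s
  refine congrArg (TotalSpace.mk _) ?_
  simp

/-- A smooth map to a single tangent space, seen as a map to the tangent bundle. -/
theorem contMDiff_mk_const {x : A} {v : S → TangentSpace IA x}
    (hv : ContMDiff (M' := EA) IS 𝓘(ℝ, EA) ∞ v) :
    ContMDiff IS IA.tangent ∞ (fun s => (⟨x, v s⟩ : TangentBundle IA A)) := by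
  intro s
  rw [contMDiffAt_totalSpace]
  refine ⟨contMDiffAt_const, (hv s).congr_of_eventuallyEq (.of_forall fun t => ?_)⟩
  -- Over its centre x, the trivialization of the tangent bundle is the identity.
  exact tangentCoordChange_self (mem_extChartAt_source x)

end PartialDerivatives

section TangentBundle

variable {EP HP P : Type*} [NormedAddCommGroup EP] [NormedSpace ℝ EP] [TopologicalSpace HP]
  {I : ModelWithCorners ℝ EP HP} [TopologicalSpace P] [ChartedSpace HP P]

/-- All tangent spaces are the same model space, so one vector can be placed over two equal points.
Needed because 1 • q and q agree only propositionally, while the derivative of an orbit map at 1 is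
based at 1 • q. -/
theorem tangentBundle_mk_congr {x y : P} (h : x = y) (v : EP) :
    (⟨x, v⟩ : TangentBundle I P) = ⟨y, v⟩ := by
  subst h; rfl

theorem mfderiv_eq_id {f : P → P} (hf : f = id) (x : P) :
    (mfderiv I I f x : EP →L[ℝ] EP) = ContinuousLinearMap.id ℝ EP := by
  subst hf
  exact mfderiv_id

end TangentBundle

/-- Comparing velocities inside TQ avoids transporting covectors between the fibres of 𝓜. -/
theorem System.ext_velocity {E : Type*} [NormedAddCommGroup E] [NormedSpace ℝ E]
    {Q : Type*} [TopologicalSpace Q] [ChartedSpace E Q] [IsManifold 𝓘(ℝ, E) ∞ Q]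
    {r : ℕ} (sys : System E Q r) {m m' : sys.ConstraintManifold}
    (h : (⟨m.1, sys.velocity m⟩ : TangentBundle 𝓘(ℝ, E) Q) = ⟨m'.1, sys.velocity m'⟩) :
    m = m' := by
  have hm := sys.flat_velocity m
  have hm' := sys.flat_velocity m'
  obtain ⟨q, α⟩ := m
  obtain ⟨q', α'⟩ := m'
  obtain rfl : q = q' := congrArg TotalSpace.proj h
  have h2 := eq_of_heq (TotalSpace.mk.inj h).2
  refine congrArg (TotalSpace.mk q) (Subtype.ext ?_)
  exact hm.symm.trans ((congrArg (sys.flat q) h2).trans hm')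

/-! ### The group action on the constraint manifold -/

section Symmetries

variable {E : Type*} [NormedAddCommGroup E] [NormedSpace ℝ E]
  {Q : Type*} [TopologicalSpace Q] [ChartedSpace E Q] [IsManifold 𝓘(ℝ, E) ∞ Q]
  {r : ℕ} {sys : System E Q r}
  {EG : Type*} [NormedAddCommGroup EG] [NormedSpace ℝ EG]
  {G : Type*} [TopologicalSpace G] [ChartedSpace EG G] [Group G]
  [MulAction G Q] [ContMDiffSMul 𝓘(ℝ, EG) 𝓘(ℝ, E) ∞ G Q]

/-- Since the tangent lift is isometric, κ^♭ intertwines it with the cotangent lift. -/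
theorem velocity_constraintAction (h : sys.IsSymmetry G) (g : G) (m : sys.ConstraintManifold) :
    sys.velocity (constraintAction EG h g m) = tangentAction E g m.1 (sys.velocity m) := by
  apply sys.flat_injective (g • m.1)
  refine (sys.flat_velocity (constraintAction EG h g m)).trans ?_
  obtain ⟨e, he⟩ := tangentAction_isInvertible (E := E) EG g m.1
  ext w
  obtain ⟨u, rfl⟩ : ∃ u, tangentAction E g m.1 u = w := ⟨e.symm w, by
    rw [← he]; exact e.apply_symm_apply w⟩
  refine Eq.trans ?_ (h.inner_eq g m.1 (sys.velocity m) u).symm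
  have : (tangentAction E g m.1).inverse (tangentAction E g m.1 u) = u := by
    rw [← he, ContinuousLinearMap.inverse_equiv]
    exact e.symm_apply_apply u
  have h2 : (m.2 : CotangentSpace E m.1) ((tangentAction E g m.1).inverse
      (tangentAction E g m.1 u)) = sys.flat m.1 (sys.velocity m) u := by
    rw [this, sys.flat_velocity]
  exact h2

theorem constraintAction_one (h : sys.IsSymmetry G) (m : sys.ConstraintManifold) :
    constraintAction EG h (1 : G) m = m := by
  have h1 : (⟨(1 : G) • m.1, tangentAction E (1 : G) m.1 (sys.velocity m)⟩ :
      TangentBundle 𝓘(ℝ, E) Q) = ⟨m.1, sys.velocity m⟩ := by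
    refine (tangentBundle_mk_congr (one_smul G m.1) _).trans (congrArg (TotalSpace.mk m.1) ?_)
    have h2 : (fun x : Q => (1 : G) • x) = id := funext (one_smul G)
    exact congrArg (fun L : E →L[ℝ] E => L (sys.velocity m))
      (mfderiv_eq_id (I := 𝓘(ℝ, E)) h2 m.1)
  refine sys.ext_velocity (Eq.trans ?_ h1)
  exact congrArg (TotalSpace.mk _) (velocity_constraintAction h 1 m)

theorem hamiltonianM_constraintAction [FiniteDimensional ℝ E] (h : sys.IsSymmetry G) (g : G)
    (m : sys.ConstraintManifold) :
    sys.hamiltonianM (constraintAction EG h g m) = sys.hamiltonianM m := by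
  rw [sys.hamiltonianM_eq, sys.hamiltonianM_eq, velocity_constraintAction]
  -- At zero velocity, invariance of L is invariance of the potential.
  have h0 := h.lagrangian_eq g m.1 0
  have h1 := h.inner_eq g m.1 (sys.velocity m) (sys.velocity m)
  simp only [System.lagrangian, map_zero] at h0
  change sys.metric.inner (g • m.1) (tangentAction E g m.1 (sys.velocity m))
    (tangentAction E g m.1 (sys.velocity m)) / 2 + sys.potential (g • m.1) = _
  rw [h1]
  linarith

variable [LieGroup 𝓘(ℝ, EG) ∞ G]

/-- On velocities the action is the partial derivative of (g, q) ↦ g • q along Q, which is jointly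
smooth. -/
theorem constraintAction_contMDiff (h : sys.IsSymmetry G) :
    ContMDiff (𝓘(ℝ, EG).prod sys.constraintModel) sys.constraintModel ∞
      (fun p : G × sys.ConstraintManifold => constraintAction EG h p.1 p.2) := by
  intro p
  refine sys.contMDiffAt_of_velocity ?_
  have hΦ : ContMDiff (𝓘(ℝ, EG).prod 𝓘(ℝ, E)) 𝓘(ℝ, E) ∞ (fun p : G × Q => p.1 • p.2) :=
    ContMDiffSMul.contMDiff_smul
  have h1 := contMDiff_mfderiv_right hΦ (contMDiff_fst (I := 𝓘(ℝ, EG)) (J := sys.constraintModel)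
    (M := G) (N := sys.ConstraintManifold) (n := ∞))
    (sys.velocity_contMDiff.comp contMDiff_snd)
  refine (h1 p).congr_of_eventuallyEq (.of_forall fun p => ?_)
  exact congrArg (TotalSpace.mk _) (velocity_constraintAction h p.1 p.2)

theorem SectionGS.onQ_contMDiff (ξ : SectionGS sys EG G) :
    ContMDiff 𝓘(ℝ, E) 𝓘(ℝ, E).tangent ∞
      (fun q => (⟨q, ξ.onQ q⟩ : TangentBundle 𝓘(ℝ, E) Q)) := by
  have hΦ : ContMDiff (𝓘(ℝ, EG).prod 𝓘(ℝ, E)) 𝓘(ℝ, E) ∞ (fun p : G × Q => p.1 • p.2) :=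
    ContMDiffSMul.contMDiff_smul
  have h1 := contMDiff_mfderiv_left hΦ (contMDiff_mk_const ξ.smooth) contMDiff_id
  convert h1 using 2 with q
  exact (tangentBundle_mk_congr (one_smul G q) _).symm

theorem SectionGS.onM_contMDiff (ξ : SectionGS sys EG G) (h : sys.IsSymmetry G) :
    ContMDiff sys.constraintModel sys.constraintModel.tangent ∞
      (fun m => (⟨m, ξ.onM h m⟩ : TangentBundle sys.constraintModel sys.ConstraintManifold)) := by
  have h1 := contMDiff_mfderiv_left (constraintAction_contMDiff h)
    (contMDiff_mk_const (x := (1 : G)) (ξ.smooth.comp (contMDiff_proj (fun q : Q => sys.constraintFiber q)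
      (F := Fin r → ℝ)))) contMDiff_id
  convert h1 using 2 with m
  exact (tangentBundle_mk_congr (constraintAction_one h m) _).symm

end Symmetries

/-! ### One-forms, bundle projections and canonical forms in charts -/

section Charts

variable {EN HN N : Type*} [NormedAddCommGroup EN] [NormedSpace ℝ EN] [TopologicalSpace HN]
  {J : ModelWithCorners ℝ EN HN} [TopologicalSpace N] [ChartedSpace HN N]

/-- The preferred chart at x has the identity as its derivative at x, so tangent vectors at x are
already their own coordinates. -/
theorem extDerivOneForm_eq [IsManifold J 1 N] {θ : ∀ x : N, TangentSpace J x →L[ℝ] ℝ} {x : N}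
    {L : EN →L[ℝ] EN →L[ℝ] ℝ} (hL : HasFDerivAt (oneFormInChart J θ x) L (extChartAt J x x))
    (v w : EN) : extDerivOneForm J θ x v w = L v w - L w v := by
  have h : ∀ u : EN, (mfderiv J 𝓘(ℝ, EN) (extChartAt J x) x u : EN) = u := fun u =>
    congrArg (fun A : EN →L[ℝ] EN => A u) (mfderiv_extChartAt_self (I := J) (x := x))
  change fderiv ℝ (oneFormInChart J θ x) (extChartAt J x x)
    (mfderiv J 𝓘(ℝ, EN) (extChartAt J x) x v) (mfderiv J 𝓘(ℝ, EN) (extChartAt J x) x w) -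
    fderiv ℝ (oneFormInChart J θ x) (extChartAt J x x)
    (mfderiv J 𝓘(ℝ, EN) (extChartAt J x) x w) (mfderiv J 𝓘(ℝ, EN) (extChartAt J x) x v) = _
  rw [hL.fderiv, h v, h w]

variable [J.Boundaryless]

theorem eventually_mem_extChartAt_target (x : N) :
    ∀ᶠ y in 𝓝 (extChartAt J x x), y ∈ (extChartAt J x).target :=
  (isOpen_extChartAt_target x).mem_nhds (mem_extChartAt_target x)

theorem mdifferentiableAt_extChartAt_symm [IsManifold J 1 N] {x : N} {y : EN}
    (hy : y ∈ (extChartAt J x).target) :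
    MDifferentiableAt 𝓘(ℝ, EN) J (extChartAt J x).symm y := by
  have h := mdifferentiableWithinAt_extChartAt_symm hy
  rwa [J.range_eq_univ, mdifferentiableWithinAt_univ] at h

theorem mfderiv_extChartAt_symm_self [IsManifold J 1 N] (x : N) :
    (mfderiv 𝓘(ℝ, EN) J (extChartAt J x).symm (extChartAt J x x) : EN →L[ℝ] EN) =
      ContinuousLinearMap.id ℝ EN := by
  have h := mfderivWithin_range_extChartAt_symm (I := J) (x := x)
  rw [J.range_eq_univ, mfderivWithin_univ] at h
  exact h

end Charts

section FiberBundles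

variable {E Q F : Type*} [NormedAddCommGroup E] [NormedSpace ℝ E] [TopologicalSpace Q]
  [ChartedSpace E Q] {V : Q → Type*} [NormedAddCommGroup F] [NormedSpace ℝ F]
  [∀ q, TopologicalSpace (V q)]
  [TopologicalSpace (TotalSpace F V)] [FiberBundle F V]

theorem extChartAt_symm_proj (x₀ : TotalSpace F V) {y : E × F}
    (hy : y ∈ (extChartAt (𝓘(ℝ, E).prod 𝓘(ℝ, F)) x₀).target) :
    ((extChartAt (𝓘(ℝ, E).prod 𝓘(ℝ, F)) x₀).symm y).1 =
      (extChartAt 𝓘(ℝ, E) x₀.1).symm y.1 := by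
  rw [FiberBundle.extChartAt_target] at hy
  rw [FiberBundle.extChartAt]
  exact (trivializationAt F V x₀.1).proj_symm_apply' hy.1.2

theorem mfderiv_proj (x : TotalSpace F V) :
    (mfderiv (𝓘(ℝ, E).prod 𝓘(ℝ, F)) 𝓘(ℝ, E) (TotalSpace.proj : TotalSpace F V → Q) x :
      E × F →L[ℝ] E) = ContinuousLinearMap.fst ℝ E F := by
  have h : HasMFDerivAt (𝓘(ℝ, E).prod 𝓘(ℝ, F)) 𝓘(ℝ, E) (TotalSpace.proj : TotalSpace F V → Q) x
      (ContinuousLinearMap.fst ℝ E F) := by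
    refine ⟨(contMDiffAt_proj V (n := ∞) (IB := 𝓘(ℝ, E))).continuousAt, ?_⟩
    have h1 : HasFDerivAt (Prod.fst : E × F → E) (ContinuousLinearMap.fst ℝ E F)
      (extChartAt (𝓘(ℝ, E).prod 𝓘(ℝ, F)) x x) := hasFDerivAt_fst
    refine (h1.congr_of_eventuallyEq ?_).hasFDerivWithinAt
    filter_upwards [eventually_mem_extChartAt_target (J := 𝓘(ℝ, E).prod 𝓘(ℝ, F)) x] with y hy
    change extChartAt 𝓘(ℝ, E) x.1 ((extChartAt (𝓘(ℝ, E).prod 𝓘(ℝ, F)) x).symm y).1 = y.1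
    rw [extChartAt_symm_proj x hy]
    rw [FiberBundle.extChartAt_target] at hy
    exact (extChartAt 𝓘(ℝ, E) x.1).right_inv hy.1.1
  exact h.mfderiv

end FiberBundles

section Cotangent

variable {E : Type*} [NormedAddCommGroup E] [NormedSpace ℝ E]
  {Q : Type*} [TopologicalSpace Q] [ChartedSpace E Q] [IsManifold 𝓘(ℝ, E) ∞ Q]

/-- The fibre coordinate of a covector in the chart of `Q` at `q`. -/
def fiberCoord (q : Q) (β : CotangentBundle E Q) : E →L[ℝ] ℝ :=
  β.2.comp (mfderiv 𝓘(ℝ, E) 𝓘(ℝ, E) (extChartAt 𝓘(ℝ, E) q).symm (extChartAt 𝓘(ℝ, E) q β.1))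

/-- These are the classical coordinates (q, p) of T^*Q induced by a chart of Q. -/
theorem extChartAt_cotangent (α : CotangentBundle E Q) {β : CotangentBundle E Q}
    (hβ : β.1 ∈ (chartAt E α.1).source) :
    extChartAt (cotangentModel E) α β =
      (extChartAt 𝓘(ℝ, E) α.1 β.1, fiberCoord α.1 β) := by
  rw [FiberBundle.extChartAt]
  refine Prod.ext rfl ?_
  have h := TangentBundle.symmL_trivializationAt (𝕜 := ℝ) (I := 𝓘(ℝ, E)) hβ
  rw [𝓘(ℝ, E).range_eq_univ, mfderivWithin_univ] at h
  change ContinuousLinearMap.comp _ (β.2.comp _) = _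
  rw [h]
  ext u
  simp [fiberCoord]

variable {F : Type*} {V : Q → Type*} [NormedAddCommGroup F] [NormedSpace ℝ F]
  [∀ q, TopologicalSpace (V q)]
  [TopologicalSpace (TotalSpace F V)] [FiberBundle F V]
  {τ : TotalSpace F V → CotangentBundle E Q}

/-- Differentiate τ_Q ∘ τ = projection; in bundle charts both projections are the first factor. -/
theorem mfderiv_fst_of_proj_eq
    (hτ : ContMDiff (𝓘(ℝ, E).prod 𝓘(ℝ, F)) (cotangentModel E) ∞ τ) (hp : ∀ x, (τ x).1 = x.1)
    (x : TotalSpace F V) (v : E × F) :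
    (mfderiv (𝓘(ℝ, E).prod 𝓘(ℝ, F)) (cotangentModel E) τ x v : E × (E →L[ℝ] ℝ)).1 = v.1 := by
  have h1 : MDifferentiableAt (𝓘(ℝ, E).prod 𝓘(ℝ, F)) (cotangentModel E) τ x :=
    (hτ x).mdifferentiableAt (by simp)
  have h2 : MDifferentiableAt (cotangentModel E) 𝓘(ℝ, E)
      (TotalSpace.proj : CotangentBundle E Q → Q) (τ x) :=
    (contMDiffAt_proj (fun q : Q => CotangentSpace E q) (n := ∞)
      (IB := 𝓘(ℝ, E))).mdifferentiableAt (by simp)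
  have h3 := mfderiv_comp x h2 h1
  have h4 : TotalSpace.proj ∘ τ = (TotalSpace.proj : TotalSpace F V → Q) := funext hp
  have h5 : (mfderiv (𝓘(ℝ, E).prod 𝓘(ℝ, F)) 𝓘(ℝ, E) (TotalSpace.proj ∘ τ) x :
      E × F →L[ℝ] E) = ContinuousLinearMap.fst ℝ E F := by
    rw [h4]; exact mfderiv_proj x
  have h6 := mfderiv_proj (E := E) (τ x)
  have h7 := congrArg (fun L : E × F →L[ℝ] E => L v) (h3.symm.trans h5)
  have h8 := congrArg (fun L : E × (E →L[ℝ] ℝ) →L[ℝ] E =>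
    L (mfderiv (𝓘(ℝ, E).prod 𝓘(ℝ, F)) (cotangentModel E) τ x v)) h6
  exact h8.symm.trans h7

theorem hasFDerivAt_writtenInExtChartAt
    (hτ : ContMDiff (𝓘(ℝ, E).prod 𝓘(ℝ, F)) (cotangentModel E) ∞ τ) (x₀ : TotalSpace F V) :
    HasFDerivAt (writtenInExtChartAt (𝓘(ℝ, E).prod 𝓘(ℝ, F)) (cotangentModel E) x₀ τ)
      (mfderiv (𝓘(ℝ, E).prod 𝓘(ℝ, F)) (cotangentModel E) τ x₀ : E × F →L[ℝ] E × (E →L[ℝ] ℝ))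
      (extChartAt (𝓘(ℝ, E).prod 𝓘(ℝ, F)) x₀ x₀) := by
  have h := ((hτ x₀).mdifferentiableAt (by simp)).hasMFDerivAt.2
  exact h.hasFDerivAt (by rw [ModelWithCorners.range_eq_univ]; exact Filter.univ_mem)

variable [∀ q, AddCommGroup (V q)] [∀ q, Module ℝ (V q)] [VectorBundle ℝ F V]
  [ContMDiffVectorBundle ∞ F V 𝓘(ℝ, E)]

/-- The pull-back of the canonical one-form by a map over the identity of `Q`, in coordinates. -/
theorem oneFormInChart_pullback
    (hτ : ContMDiff (𝓘(ℝ, E).prod 𝓘(ℝ, F)) (cotangentModel E) ∞ τ) (hp : ∀ x, (τ x).1 = x.1)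
    (x₀ : TotalSpace F V) {y : E × F}
    (hy : y ∈ (extChartAt (𝓘(ℝ, E).prod 𝓘(ℝ, F)) x₀).target) :
    oneFormInChart (𝓘(ℝ, E).prod 𝓘(ℝ, F))
      (fun x => (canonicalOneForm (τ x)).comp
        (mfderiv (𝓘(ℝ, E).prod 𝓘(ℝ, F)) (cotangentModel E) τ x)) x₀ y =
      (writtenInExtChartAt (𝓘(ℝ, E).prod 𝓘(ℝ, F)) (cotangentModel E) x₀ τ y).2.comp
        (ContinuousLinearMap.fst ℝ E F) := by
  set φ := extChartAt (𝓘(ℝ, E).prod 𝓘(ℝ, F)) x₀ with hφ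
  set ψ := extChartAt 𝓘(ℝ, E) x₀.1 with hψ
  have hyt := hy
  rw [hφ, FiberBundle.extChartAt_target] at hyt
  have hb : (φ.symm y).1 = ψ.symm y.1 := extChartAt_symm_proj x₀ hy
  have hsrc : ψ.symm y.1 ∈ (chartAt E x₀.1).source := by
    have := ψ.map_target hyt.1.1
    rwa [hψ, extChartAt_source] at this
  have hτb : (τ (φ.symm y)).1 = ψ.symm y.1 := (hp _).trans hb
  have hw : (writtenInExtChartAt (𝓘(ℝ, E).prod 𝓘(ℝ, F)) (cotangentModel E) x₀ τ y).2 =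
      fiberCoord x₀.1 (τ (φ.symm y)) := by
    have h := extChartAt_cotangent (τ x₀) (β := τ (φ.symm y)) (by rw [hτb, hp]; exact hsrc)
    rw [hp x₀] at h
    exact congrArg Prod.snd h
  have hz : extChartAt 𝓘(ℝ, E) x₀.1 (τ (φ.symm y)).1 = y.1 := by
    rw [hτb]; exact ψ.right_inv hyt.1.1
  have h1 : MDifferentiableAt (𝓘(ℝ, E).prod 𝓘(ℝ, F)) (cotangentModel E) τ (φ.symm y) :=
    (hτ _).mdifferentiableAt (by simp)
  have h2 : MDifferentiableAt (cotangentModel E) 𝓘(ℝ, E)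
      (TotalSpace.proj : CotangentBundle E Q → Q) (τ (φ.symm y)) :=
    (contMDiffAt_proj (fun q : Q => CotangentSpace E q) (n := ∞)
      (IB := 𝓘(ℝ, E))).mdifferentiableAt (by simp)
  have h3 : MDifferentiableAt 𝓘(ℝ, E × F) (𝓘(ℝ, E).prod 𝓘(ℝ, F)) φ.symm y :=
    mdifferentiableAt_extChartAt_symm hy
  have h4 := (h2.hasMFDerivAt.comp _ h1.hasMFDerivAt).comp y h3.hasMFDerivAt
  have h5 : HasMFDerivAt 𝓘(ℝ, E) 𝓘(ℝ, E) ψ.symm y.1 (mfderiv 𝓘(ℝ, E) 𝓘(ℝ, E) ψ.symm y.1) :=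
    (mdifferentiableAt_extChartAt_symm hyt.1.1).hasMFDerivAt
  have h6 : HasMFDerivAt 𝓘(ℝ, E × F) 𝓘(ℝ, E) (Prod.fst : E × F → E) y
      (ContinuousLinearMap.fst ℝ E F) := hasFDerivAt_fst.hasMFDerivAt
  have h7 := (h5.comp y h6).congr_of_eventuallyEq (f₁ := (TotalSpace.proj ∘ τ) ∘ φ.symm) (by
    filter_upwards [(isOpen_extChartAt_target x₀).mem_nhds hy] with z hz
    exact (hp _).trans (extChartAt_symm_proj x₀ hz))
  -- The base map of τ in the chart factors in two ways: through T^*Q, as in the definition of Θ_Q,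
  -- and through the first coordinate. Equating the derivatives leaves the fibre coordinate p ∘ τ
  -- paired with dq.
  have h8 := hasMFDerivAt_unique h4 h7
  rw [hw]
  refine ContinuousLinearMap.ext fun u => ?_
  refine (congrArg (τ (φ.symm y)).2 (congrArg (fun L : E × F →L[ℝ] E => L u) h8)).trans ?_
  unfold fiberCoord
  rw [hz]
  rfl

/-- In coordinates the form is a fixed linear map applied to the momentum component of τ, so its
derivative is read off from that of τ. -/
theorem hasFDerivAt_oneFormInChart_pullback
    (hτ : ContMDiff (𝓘(ℝ, E).prod 𝓘(ℝ, F)) (cotangentModel E) ∞ τ) (hp : ∀ x, (τ x).1 = x.1)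
    (x₀ : TotalSpace F V) :
    HasFDerivAt (oneFormInChart (𝓘(ℝ, E).prod 𝓘(ℝ, F))
      (fun x => (canonicalOneForm (τ x)).comp
        (mfderiv (𝓘(ℝ, E).prod 𝓘(ℝ, F)) (cotangentModel E) τ x)) x₀)
      (((ContinuousLinearMap.compL ℝ (E × F) E ℝ).flip (ContinuousLinearMap.fst ℝ E F)).comp
        ((ContinuousLinearMap.snd ℝ E (E →L[ℝ] ℝ)).comp
          (mfderiv (𝓘(ℝ, E).prod 𝓘(ℝ, F)) (cotangentModel E) τ x₀ :
            E × F →L[ℝ] E × (E →L[ℝ] ℝ))))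
      (extChartAt (𝓘(ℝ, E).prod 𝓘(ℝ, F)) x₀ x₀) := by
  have h := (((ContinuousLinearMap.compL ℝ (E × F) E ℝ).flip
    (ContinuousLinearMap.fst ℝ E F)).hasFDerivAt.comp _
      ((ContinuousLinearMap.snd ℝ E (E →L[ℝ] ℝ)).hasFDerivAt.comp _
        (hasFDerivAt_writtenInExtChartAt hτ x₀)))
  refine h.congr_of_eventuallyEq ?_
  filter_upwards [eventually_mem_extChartAt_target (J := 𝓘(ℝ, E).prod 𝓘(ℝ, F)) x₀] with y hy
  exact oneFormInChart_pullback hτ hp x₀ hy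

theorem extDerivOneForm_pullback
    (hτ : ContMDiff (𝓘(ℝ, E).prod 𝓘(ℝ, F)) (cotangentModel E) ∞ τ) (hp : ∀ x, (τ x).1 = x.1)
    (x : TotalSpace F V) (v w : E × F) :
    extDerivOneForm (𝓘(ℝ, E).prod 𝓘(ℝ, F))
      (fun x => (canonicalOneForm (τ x)).comp
        (mfderiv (𝓘(ℝ, E).prod 𝓘(ℝ, F)) (cotangentModel E) τ x)) x v w =
      (mfderiv (𝓘(ℝ, E).prod 𝓘(ℝ, F)) (cotangentModel E) τ x v : E × (E →L[ℝ] ℝ)).2 w.1 -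
      (mfderiv (𝓘(ℝ, E).prod 𝓘(ℝ, F)) (cotangentModel E) τ x w : E × (E →L[ℝ] ℝ)).2 v.1 := by
  exact extDerivOneForm_eq (hasFDerivAt_oneFormInChart_pullback hτ hp x) v w

/-- The pull-back formula for τ = id: Ω_Q is dq ∧ dp in the bundle chart. -/
theorem canonicalTwoForm_apply (α : CotangentBundle E Q) (v w : E × (E →L[ℝ] ℝ)) :
    canonicalTwoForm α v w = w.2 v.1 - v.2 w.1 := by
  have h := extDerivOneForm_pullback (τ := (id : CotangentBundle E Q → CotangentBundle E Q))
    contMDiff_id (fun _ => rfl) α v w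
  simp only [mfderiv_id] at h
  have h2 : canonicalTwoForm α v w = -((v.2 : E →L[ℝ] ℝ) w.1 - w.2 v.1) := congrArg Neg.neg h
  rw [h2]; ring

end Cotangent

/-! ### Linear symplectic algebra and Hamiltonian vector fields -/

section Linear

/-- A linear functional is represented, on a subspace `W`, by a bilinear form which is
nondegenerate on `W`. -/
theorem exists_mem_forall_eq {V : Type*} [AddCommGroup V] [Module ℝ V] [FiniteDimensional ℝ V]
    (B : V →ₗ[ℝ] V →ₗ[ℝ] ℝ) (W : Submodule ℝ V)
    (hB : ∀ v ∈ W, (∀ w ∈ W, B v w = 0) → v = 0) (φ : V →ₗ[ℝ] ℝ) :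
    ∃ v ∈ W, ∀ w ∈ W, B v w = φ w := by
  let B' : W →ₗ[ℝ] Module.Dual ℝ W := B.domRestrict₁₂ W W
  have hinj : Function.Injective B' := by
    rw [injective_iff_map_eq_zero]
    intro v hv
    ext1
    exact hB v v.2 fun w hw => congrArg (fun f : Module.Dual ℝ W => f ⟨w, hw⟩) hv
  obtain ⟨v, hv⟩ := (LinearMap.injective_iff_surjective_of_finrank_eq_finrank
    (Subspace.dual_finrank_eq (K := ℝ) (V := W)).symm).1 hinj (φ.domRestrict W)
  exact ⟨v, v.2, fun w hw => congrArg (fun f : Module.Dual ℝ W => f ⟨w, hw⟩) hv⟩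

/-- The canonical symplectic form of `E × E^*`. -/
def symplecticForm (E : Type*) [NormedAddCommGroup E] [NormedSpace ℝ E] :
    (E × (E →L[ℝ] ℝ)) →ₗ[ℝ] (E × (E →L[ℝ] ℝ)) →ₗ[ℝ] ℝ :=
  LinearMap.mk₂ ℝ (fun v w => w.2 v.1 - v.2 w.1)
    (fun u v w => by simp; ring) (fun a v w => by simp; ring)
    (fun u v w => by simp; ring) (fun a v w => by simp; ring)

theorem symplecticForm_apply {E : Type*} [NormedAddCommGroup E] [NormedSpace ℝ E]
    (v w : E × (E →L[ℝ] ℝ)) : symplecticForm E v w = w.2 v.1 - v.2 w.1 := rfl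

theorem symplecticForm_nondegenerate {E : Type*} [NormedAddCommGroup E] [NormedSpace ℝ E]
    (v : E × (E →L[ℝ] ℝ)) (hv : ∀ w, symplecticForm E v w = 0) : v = 0 := by
  refine Prod.ext ?_ ?_
  · by_contra h
    obtain ⟨f, hf⟩ := SeparatingDual.exists_ne_zero (R := ℝ) h
    refine hf ?_
    simpa [symplecticForm_apply] using hv (0, f)
  · ext u
    simpa [symplecticForm_apply] using hv (u, 0)

end Linear

section Cotangent

variable {E : Type*} [NormedAddCommGroup E] [NormedSpace ℝ E]
  {Q : Type*} [TopologicalSpace Q] [ChartedSpace E Q] [IsManifold 𝓘(ℝ, E) ∞ Q]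

theorem canonicalTwoForm_swap (α : CotangentBundle E Q)
    (v w : TangentSpace (cotangentModel E) α) :
    canonicalTwoForm α v w = -canonicalTwoForm α w v := by
  simp only [canonicalTwoForm, extDerivOneForm]
  ring

theorem canonicalTwoForm_hamiltonianVectorField [FiniteDimensional ℝ E]
    (f : CotangentBundle E Q → ℝ) (α : CotangentBundle E Q)
    (w : TangentSpace (cotangentModel E) α) :
    canonicalTwoForm α (hamiltonianVectorField f α) w =
      differential (cotangentModel E) f α w := by
  have hex : ∃ z : TangentSpace (cotangentModel E) α, ∀ w, canonicalTwoForm α z w =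
      differential (cotangentModel E) f α w := by
    let φ : E × (E →L[ℝ] ℝ) →L[ℝ] ℝ := differential (cotangentModel E) f α
    obtain ⟨z, -, hz⟩ := exists_mem_forall_eq (symplecticForm E) ⊤
      (fun v _ hv => symplecticForm_nondegenerate v fun w => hv w trivial) φ.toLinearMap
    exact ⟨z, fun w => (canonicalTwoForm_apply α z w).trans (hz w trivial)⟩
  exact Classical.epsilon_spec hex w

theorem contMDiff_apply_vectorField {X : ∀ q : Q, TangentSpace 𝓘(ℝ, E) q}
    (hX : ContMDiff 𝓘(ℝ, E) 𝓘(ℝ, E).tangent ∞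
      (fun q => (⟨q, X q⟩ : TangentBundle 𝓘(ℝ, E) Q))) :
    ContMDiff (cotangentModel E) 𝓘(ℝ, ℝ) ∞ (fun β : CotangentBundle E Q => β.2 (X β.1)) := by
  intro α
  -- The identity of T^*Q, reread as a smooth family of functionals over the base map, can be
  -- evaluated on X.
  have hid : ContMDiff (cotangentModel E) (cotangentModel E) ∞
    (fun β : CotangentBundle E Q => TotalSpace.mk' (E →L[ℝ] ℝ) β.1 β.2) := contMDiff_id
  have h := ContMDiff.clm_bundle_apply (E₁ := fun q : Q => TangentSpace 𝓘(ℝ, E) q)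
    (E₂ := Bundle.Trivial Q ℝ) hid
    (hX.comp (contMDiff_proj (fun q : Q => CotangentSpace E q)))
  exact (contMDiffAt_totalSpace.1 (h α)).2

end Cotangent

/-! ### Nondegeneracy of the two-form on 𝓒 -/

namespace System

variable {E : Type*} [NormedAddCommGroup E] [NormedSpace ℝ E]
  {Q : Type*} [TopologicalSpace Q] [ChartedSpace E Q] [IsManifold 𝓘(ℝ, E) ∞ Q]
  {r : ℕ} (sys : System E Q r)

/-- The derivative of the inclusion, on the model spaces. -/
def inclDerivCoord (m : sys.ConstraintManifold) :
    E × (Fin r → ℝ) →L[ℝ] E × (E →L[ℝ] ℝ) := sys.inclDeriv m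

theorem inclDerivCoord_fst (m : sys.ConstraintManifold) (v : E × (Fin r → ℝ)) :
    (sys.inclDerivCoord m v).1 = v.1 :=
  mfderiv_fst_of_proj_eq sys.incl_contMDiff (fun _ => rfl) m v

theorem twoFormM_apply (m : sys.ConstraintManifold) (v w : E × (Fin r → ℝ)) :
    sys.twoFormM m v w =
      symplecticForm E (sys.inclDerivCoord m v) (sys.inclDerivCoord m w) :=
  canonicalTwoForm_apply _ _ _

theorem extDerivOneForm_oneFormM (m : sys.ConstraintManifold)
    (v w : E × (Fin r → ℝ)) :
    extDerivOneForm sys.constraintModel sys.oneFormM m v w = -sys.twoFormM m v w := by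
  refine (extDerivOneForm_pullback sys.incl_contMDiff (fun _ => rfl) m v w).trans ?_
  have h := sys.twoFormM_apply m v w
  rw [symplecticForm_apply, inclDerivCoord_fst, inclDerivCoord_fst] at h
  rw [h, neg_sub]
  rfl

theorem mem_C_iff (m : sys.ConstraintManifold) (v : E × (Fin r → ℝ)) :
    v ∈ sys.C m ↔ v.1 ∈ sys.D.space m.1 := by
  have h := congrArg (fun L : E × (Fin r → ℝ) →L[ℝ] E => L v) (mfderiv_proj (E := E) m)
  exact iff_of_eq (congrArg (fun u : E => u ∈ sys.D.space m.1) h)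

/-- On a fibre the inclusion is linear, so it is its own derivative there: a vertical vector goes to
the covector with those frame coefficients. -/
theorem inclDerivCoord_vertical (m : sys.ConstraintManifold) (c : Fin r → ℝ) :
    (sys.inclDerivCoord m (0, c)).2 =
      ((frameBasis (sys.frameAt m.1) (sys.mem_frameAt m.1)).equivFun.symm c :
        CotangentSpace E m.1) := by
  set b := frameBasis (sys.frameAt m.1) (sys.mem_frameAt m.1) with hb
  set y₀ := extChartAt sys.constraintModel m m with hy₀
  have hchart : ∀ α : sys.constraintFiber m.1,
      extChartAt sys.constraintModel m ⟨m.1, α⟩ = (y₀.1, b.equivFun α) := by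
    intro α
    rw [hy₀, FiberBundle.extChartAt]
    refine Prod.ext rfl ?_
    have h := congrArg Prod.snd (sys.pretrivialization_apply _ (sys.mem_frameAt m.1) α)
    exact h
  have hsymm : ∀ c : Fin r → ℝ, (extChartAt sys.constraintModel m).symm (y₀.1, c) =
      ⟨m.1, b.equivFun.symm c⟩ := by
    intro c
    have h := hchart (b.equivFun.symm c)
    rw [LinearEquiv.apply_symm_apply] at h
    rw [← h]
    refine (extChartAt sys.constraintModel m).left_inv ?_
    rw [FiberBundle.extChartAt]
    simp only [mfld_simps]
    exact ⟨sys.mem_frameAt m.1, mem_chart_source E m.1⟩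
  let L : (Fin r → ℝ) →L[ℝ] (E →L[ℝ] ℝ) := LinearMap.toContinuousLinearMap
    ((sys.constraintFiber m.1).subtype.comp b.equivFun.symm.toLinearMap :
      (Fin r → ℝ) →ₗ[ℝ] (E →L[ℝ] ℝ))
  have hw : ∀ c, writtenInExtChartAt sys.constraintModel (cotangentModel E) m sys.incl
      (y₀.1, c) = (y₀.1, L c) := by
    intro c
    change extChartAt (cotangentModel E) (sys.incl m) (sys.incl
      ((extChartAt sys.constraintModel m).symm (y₀.1, c))) = _
    rw [hsymm, extChartAt_cotangent _ (mem_chart_source E m.1)]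
    refine Prod.ext rfl ?_
    refine ContinuousLinearMap.ext fun u => ?_
    -- At the centre of the chart the fibre coordinate of a covector is the covector itself.
    exact congrArg (L c) (congrArg (fun A : E →L[ℝ] E => A u)
      (mfderiv_extChartAt_symm_self (J := 𝓘(ℝ, E)) m.1))
  have h1 : HasFDerivAt (writtenInExtChartAt sys.constraintModel (cotangentModel E) m sys.incl)
      (sys.inclDerivCoord m) (y₀.1, y₀.2) :=
    hasFDerivAt_writtenInExtChartAt sys.incl_contMDiff m
  have h2 := h1.comp y₀.2 (hasFDerivAt_prodMk_right y₀.1 y₀.2)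
  have h3 : HasFDerivAt (fun c => (y₀.1, L c)) ((0 : (Fin r → ℝ) →L[ℝ] E).prod L) y₀.2 :=
    (hasFDerivAt_const _ _).prodMk L.hasFDerivAt
  have h4 := h2.unique (h3.congr_of_eventuallyEq (.of_forall hw))
  exact congrArg Prod.snd (congrArg (fun A : (Fin r → ℝ) →L[ℝ] E × (E →L[ℝ] ℝ) => A c) h4)

theorem twoFormM_nondegenerate (m : sys.ConstraintManifold) (v : E × (Fin r → ℝ))
    (hv : v.1 ∈ sys.D.space m.1) (h : ∀ w : E × (Fin r → ℝ), w.1 ∈ sys.D.space m.1 →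
      symplecticForm E (sys.inclDerivCoord m v) (sys.inclDerivCoord m w) = 0) : v = 0 := by
  simp only [symplecticForm_apply, inclDerivCoord_fst] at h
  set b := frameBasis (sys.frameAt m.1) (sys.mem_frameAt m.1) with hb
  obtain ⟨u, c⟩ := v
  have hu : u = 0 := by
    by_contra hu
    -- The vertical vector with covector κ^♭(u), available because u ∈ D, gives κ(u, u) = 0.
    have h1 := h (0, b.equivFun ⟨sys.flat m.1 u, u, hv, rfl⟩) (Submodule.zero_mem _)
    rw [inclDerivCoord_vertical, LinearEquiv.symm_apply_apply] at h1
    simp only [map_zero, sub_zero] at h1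
    exact absurd h1 (ne_of_gt (sys.metric.pos m.1 u hu))
  subst hu
  have hc : b.equivFun.symm c = 0 := by
    obtain ⟨d, hd, hdc⟩ := (b.equivFun.symm c).2
    -- Now v is vertical with covector κ^♭(d), d ∈ D; a vector of 𝓒 lying over d gives κ(d, d) = 0.
    have h1 := h (d, 0) hd
    rw [inclDerivCoord_vertical, ← hb, ← hdc] at h1
    simp only [map_zero, zero_sub, neg_eq_zero] at h1
    have hd0 : d = 0 := by
      by_contra hd0
      exact absurd h1 (ne_of_gt (sys.metric.pos m.1 d hd0))
    ext1
    rw [← hdc, hd0]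
    exact map_zero _
  exact Prod.ext rfl ((LinearEquiv.map_eq_zero_iff _).1 hc)

/-- `Ω_𝓜` is nondegenerate on `𝓒`: every functional is represented on `𝓒` by a vector of `𝓒`. -/
theorem exists_mem_C [FiniteDimensional ℝ E] (m : sys.ConstraintManifold)
    (φ : E × (Fin r → ℝ) →ₗ[ℝ] ℝ) :
    ∃ v : TangentSpace sys.constraintModel m, v ∈ sys.C m ∧
      ∀ w ∈ sys.C m, sys.twoFormM m v w = φ w := by
  let W : Submodule ℝ (E × (Fin r → ℝ)) := sys.C m
  obtain ⟨v, hv, h⟩ := exists_mem_forall_eq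
    ((symplecticForm E).compl₁₂ (sys.inclDerivCoord m).toLinearMap
      (sys.inclDerivCoord m).toLinearMap) W
    (fun v hv h => sys.twoFormM_nondegenerate m v ((sys.mem_C_iff m v).1 hv)
      fun w hw => h w ((sys.mem_C_iff m w).2 hw)) φ
  exact ⟨v, hv, fun w hw => (sys.twoFormM_apply m v w).trans (h w hw)⟩

theorem Xnh_spec [FiniteDimensional ℝ E] (m : sys.ConstraintManifold) :
    sys.Xnh m ∈ sys.C m ∧ ∀ w ∈ sys.C m, sys.twoFormM m (sys.Xnh m) w =
      differential sys.constraintModel sys.hamiltonianM m w :=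
  Classical.epsilon_spec (sys.exists_mem_C m
    (differential sys.constraintModel sys.hamiltonianM m).toLinearMap)

/-- The orthogonality that defines the projection, rewritten by bilinearity: against 𝓒, a vector z
may be replaced by its projection. -/
theorem projC_spec [FiniteDimensional ℝ E] (m : sys.ConstraintManifold)
    (z : TangentSpace (cotangentModel E) (sys.incl m)) :
    sys.projC m z ∈ sys.C m ∧ ∀ w ∈ sys.C m,
      sys.twoFormM m (sys.projC m z) w = canonicalTwoForm (sys.incl m) z (sys.inclDeriv m w) := by
  have hsub : ∀ v w, canonicalTwoForm (sys.incl m) (z - sys.inclDeriv m v) (sys.inclDeriv m w) =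
      canonicalTwoForm (sys.incl m) z (sys.inclDeriv m w) - sys.twoFormM m v w := by
    intro v w
    have h := LinearMap.map_sub₂ (symplecticForm E) z (sys.inclDerivCoord m v)
      (sys.inclDerivCoord m w)
    exact (canonicalTwoForm_apply _ _ _).trans (h.trans (congrArg₂ (· - ·)
      (canonicalTwoForm_apply _ _ _).symm (sys.twoFormM_apply m v w).symm))
  obtain ⟨v, hv, h⟩ := sys.exists_mem_C m
    ((symplecticForm E z).comp (sys.inclDerivCoord m).toLinearMap)
  have hz : ∀ w, canonicalTwoForm (sys.incl m) z (sys.inclDeriv m w) =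
      ((symplecticForm E z).comp (sys.inclDerivCoord m).toLinearMap) w :=
    fun w => canonicalTwoForm_apply _ _ _
  have hex : ∃ v, v ∈ sys.C m ∧ ∀ w ∈ sys.C m,
      canonicalTwoForm (sys.incl m) (z - sys.inclDeriv m v) (sys.inclDeriv m w) = 0 :=
    ⟨v, hv, fun w hw => by rw [hsub, h w hw, hz, sub_self]⟩
  have hs := Classical.epsilon_spec hex
  exact ⟨hs.1, fun w hw => (sub_eq_zero.1 ((hsub _ w).symm.trans (hs.2 w hw))).symm⟩

end System

/-! ### Cartan's formula in charts -/

section Cartan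

variable {EN HN N : Type*} [NormedAddCommGroup EN] [NormedSpace ℝ EN]
  [TopologicalSpace HN]
  {J : ModelWithCorners ℝ EN HN} [J.Boundaryless] [TopologicalSpace N] [ChartedSpace HN N]
  [IsManifold J ∞ N]

theorem isInvertible_mfderiv_extChartAt_symm {x : N} {y : EN}
    (hy : y ∈ (extChartAt J x).target) :
    (mfderiv 𝓘(ℝ, EN) J (extChartAt J x).symm y).IsInvertible := by
  have h := isInvertible_mfderivWithin_extChartAt_symm hy
  rwa [J.range_eq_univ, mfderivWithin_univ] at h

theorem vectorFieldInChart_self (X : ∀ x : N, TangentSpace J x) (x : N) :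
    vectorFieldInChart J X x (extChartAt J x x) = (X x : EN) := by
  have hx : (X ((extChartAt J x).symm (extChartAt J x x)) : EN) = X x := by
    rw [extChartAt_to_inv]
  have h : ∀ A : EN →L[ℝ] EN, A = ContinuousLinearMap.id ℝ EN →
      A.inverse (X ((extChartAt J x).symm (extChartAt J x x))) = (X x : EN) := by
    rintro _ rfl
    rw [ContinuousLinearMap.inverse_id]
    exact hx
  exact h _ (mfderiv_extChartAt_symm_self x)

variable [CompleteSpace EN]

theorem differentiableAt_vectorFieldInChart {X : ∀ x : N, TangentSpace J x}
    (hX : ContMDiff J J.tangent ∞ (fun x => (⟨x, X x⟩ : TangentBundle J N))) (x : N) :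
    DifferentiableAt ℝ (vectorFieldInChart J X x) (extChartAt J x x) := by
  have hf : ContMDiffAt 𝓘(ℝ, EN) J ∞ (extChartAt J x).symm (extChartAt J x x) :=
    (contMDiffOn_extChartAt_symm x).contMDiffAt
      ((isOpen_extChartAt_target x).mem_nhds (mem_extChartAt_target x))
  have h := ContMDiffAt.mpullback_vectorField_preimage (m := 1) (n := ∞)
    ((hX _).of_le (by simp)) hf
    (isInvertible_mfderiv_extChartAt_symm (mem_extChartAt_target x)) (by norm_cast)
  exact (contMDiffAt_vectorSpace_iff_contDiffAt.1 h).differentiableAt (by simp)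

/-- The Cartan formula `£_X θ = i_X dθ + d(θ(X))`. -/
theorem lieDerivOneForm_eq {X : ∀ x : N, TangentSpace J x}
    (hX : ContMDiff J J.tangent ∞ (fun x => (⟨x, X x⟩ : TangentBundle J N)))
    {θ : ∀ x : N, TangentSpace J x →L[ℝ] ℝ} {x : N}
    (hθ : DifferentiableAt ℝ (oneFormInChart J θ x) (extChartAt J x x))
    (hθX : MDifferentiableAt J 𝓘(ℝ, ℝ) (fun x => θ x (X x)) x) (v : TangentSpace J x) :
    lieDerivOneForm J X θ x v =
      extDerivOneForm J θ x (X x) v + differential J (fun x => θ x (X x)) x v := by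
  have hv : ∀ u : EN, (mfderiv J 𝓘(ℝ, EN) (extChartAt J x) x u : EN) = u := fun u =>
    congrArg (fun A : EN →L[ℝ] EN => A u) (mfderiv_extChartAt_self (I := J) (x := x))
  have hXd := differentiableAt_vectorFieldInChart hX x
  have h1 : HasFDerivAt (fun y => oneFormInChart J θ x y (vectorFieldInChart J X x y))
      _ (extChartAt J x x) := hθ.hasFDerivAt.clm_apply hXd.hasFDerivAt
  let A : EN →L[ℝ] ℝ := mfderiv J 𝓘(ℝ, ℝ) (fun x => θ x (X x)) x
  have h2 : HasFDerivAt (writtenInExtChartAt J 𝓘(ℝ, ℝ) x (fun x => θ x (X x))) A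
      (extChartAt J x x) :=
    hθX.hasMFDerivAt.2.hasFDerivAt
      (by rw [ModelWithCorners.range_eq_univ]; exact Filter.univ_mem)
  have h3 : writtenInExtChartAt J 𝓘(ℝ, ℝ) x (fun x => θ x (X x)) =ᶠ[𝓝 (extChartAt J x x)]
      fun y => oneFormInChart J θ x y (vectorFieldInChart J X x y) := by
    filter_upwards [eventually_mem_extChartAt_target (J := J) x] with y hy
    refine congrArg (θ ((extChartAt J x).symm y)) ?_
    -- The field in the chart is the pull-back of X, and the chart derivative is invertible, so
    -- pushing it forward returns X.
    obtain ⟨e, he⟩ := isInvertible_mfderiv_extChartAt_symm hy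
    change _ = mfderiv 𝓘(ℝ, EN) J (extChartAt J x).symm y
      ((mfderiv 𝓘(ℝ, EN) J (extChartAt J x).symm y).inverse (X ((extChartAt J x).symm y)))
    rw [← he, ContinuousLinearMap.inverse_equiv]
    exact (e.apply_symm_apply _).symm
  have h4 := congrArg (fun A : EN →L[ℝ] ℝ => A v) (h2.unique (h1.congr_of_eventuallyEq h3))
  have h5 := extDerivOneForm_eq hθ.hasFDerivAt (X x) v
  have h6 : lieDerivOneForm J X θ x v = fderiv ℝ (oneFormInChart J θ x) (extChartAt J x x)
      (X x) v + oneFormInChart J θ x (extChartAt J x x)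
        (fderiv ℝ (vectorFieldInChart J X x) (extChartAt J x x) v) := by
    have h : ∀ a u : EN, a = X x → u = v →
        fderiv ℝ (oneFormInChart J θ x) (extChartAt J x x) a u +
          oneFormInChart J θ x (extChartAt J x x)
            (fderiv ℝ (vectorFieldInChart J X x) (extChartAt J x x) u) =
        fderiv ℝ (oneFormInChart J θ x) (extChartAt J x x) (X x) v +
          oneFormInChart J θ x (extChartAt J x x)
            (fderiv ℝ (vectorFieldInChart J X x) (extChartAt J x x) v) := by
      rintro _ _ rfl rfl; rfl
    exact h _ _ (vectorFieldInChart_self X x) (hv v)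
  have h7 : differential J (fun x => θ x (X x)) x v =
      oneFormInChart J θ x (extChartAt J x x)
        (fderiv ℝ (vectorFieldInChart J X x) (extChartAt J x x) v) +
      fderiv ℝ (oneFormInChart J θ x) (extChartAt J x x) v (X x) := by
    rw [← vectorFieldInChart_self X x]
    exact h4
  rw [h6, h7, h5]
  ring

end Cartan

/-! ### Invariance of the Hamiltonian, the momentum and the two key identities -/

section Symmetries

variable {E : Type*} [NormedAddCommGroup E] [NormedSpace ℝ E]
  {Q : Type*} [TopologicalSpace Q] [ChartedSpace E Q] [IsManifold 𝓘(ℝ, E) ∞ Q]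
  {r : ℕ} {sys : System E Q r}
  {EG : Type*} [NormedAddCommGroup EG] [NormedSpace ℝ EG]
  {G : Type*} [TopologicalSpace G] [ChartedSpace EG G] [Group G] [LieGroup 𝓘(ℝ, EG) ∞ G]
  [MulAction G Q] [ContMDiffSMul 𝓘(ℝ, EG) 𝓘(ℝ, E) ∞ G Q]

/-- Chain rule for a function of an orbit map on `𝓜`. -/
theorem mfderiv_comp_constraintAction {EP HP P : Type*} [NormedAddCommGroup EP]
    [NormedSpace ℝ EP] [TopologicalSpace HP] {I : ModelWithCorners ℝ EP HP} [TopologicalSpace P]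
    [ChartedSpace HP P] (h : sys.IsSymmetry G) {f : sys.ConstraintManifold → P}
    (m : sys.ConstraintManifold)
    (hf : MDifferentiableAt sys.constraintModel I f m) (η : EG) :
    (mfderiv 𝓘(ℝ, EG) I (fun g : G => f (constraintAction EG h g m)) 1 η : EP) =
      (mfderiv sys.constraintModel I f m (generatorM EG h m η) : EP) := by
  have h1 : MDifferentiableAt 𝓘(ℝ, EG) sys.constraintModel
      (fun g : G => constraintAction EG h g m) 1 :=
    (((constraintAction_contMDiff h).comp
      (contMDiff_id.prodMk contMDiff_const)) (1 : G)).mdifferentiableAt (by simp)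
  have h1m := constraintAction_one (EG := EG) h m
  have h2 := mfderiv_comp (1 : G) (f := fun g : G => constraintAction EG h g m) (g := f)
    (by rw [h1m]; exact hf) h1
  have h3 := congrArg (fun A : EG →L[ℝ] EP => A η) h2
  refine h3.trans ?_
  -- The chain rule yields the derivative of f at 1 · m; this moves it to m.
  have h4 : ∀ m' : sys.ConstraintManifold, m' = m → ∀ u : E × (Fin r → ℝ),
      (mfderiv sys.constraintModel I f m' u : EP) =
        mfderiv sys.constraintModel I f m u := by
    rintro _ rfl _; rfl
  exact h4 _ h1m _

theorem differential_hamiltonianM_generatorM [FiniteDimensional ℝ E] (h : sys.IsSymmetry G)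
    (m : sys.ConstraintManifold) (η : EG) :
    differential sys.constraintModel sys.hamiltonianM m (generatorM EG h m η) = 0 := by
  refine (mfderiv_comp_constraintAction h m
    ((sys.hamiltonianM_contMDiff m).mdifferentiableAt (by simp)) η).symm.trans ?_
  have h1 : (fun g : G => sys.hamiltonianM (constraintAction EG h g m)) =
      fun _ => sys.hamiltonianM m := funext fun g => hamiltonianM_constraintAction h g m
  have h2 : ∀ f : G → ℝ, f = (fun _ => sys.hamiltonianM m) →
      (mfderiv 𝓘(ℝ, EG) 𝓘(ℝ, ℝ) f 1 η : ℝ) = 0 := by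
    rintro _ rfl
    rw [mfderiv_const]
    rfl
  exact h2 _ h1

/-- The projection of 𝓜 is equivariant, so it carries generators on 𝓜 to generators on Q. -/
theorem generatorM_fst (h : sys.IsSymmetry G) (m : sys.ConstraintManifold) (η : EG) :
    (generatorM EG h m η : E × (Fin r → ℝ)).1 = generatorQ E EG (G := G) m.1 η := by
  have h1 := mfderiv_comp_constraintAction h (I := 𝓘(ℝ, E)) m
    (f := (TotalSpace.proj : sys.ConstraintManifold → Q))
    ((contMDiffAt_proj (fun q : Q => sys.constraintFiber q) (n := ∞)
      (IB := 𝓘(ℝ, E))).mdifferentiableAt (by simp)) η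
  have h2 := congrArg (fun L : E × (Fin r → ℝ) →L[ℝ] E => L (generatorM EG h m η))
    (mfderiv_proj (E := E) m)
  exact h2.symm.trans h1.symm

theorem System.oneFormM_apply (sys : System E Q r) (m : sys.ConstraintManifold)
    (v : E × (Fin r → ℝ)) :
    sys.oneFormM m v = (m.2 : CotangentSpace E m.1) v.1 := by
  have h := congrArg (fun L : E × (E →L[ℝ] ℝ) →L[ℝ] E => L (sys.inclDerivCoord m v))
    (mfderiv_proj (E := E) (sys.incl m))
  exact congrArg (m.2 : CotangentSpace E m.1) (h.trans (sys.inclDerivCoord_fst m v))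

namespace SectionGS

variable (ξ : SectionGS sys EG G) (h : sys.IsSymmetry G)

theorem onM_mem_C (m : sys.ConstraintManifold) : ξ.onM h m ∈ sys.C m := by
  refine (sys.mem_C_iff m _).2 ?_
  have h1 : generatorQ E EG m.1 (ξ.toFun m.1) ∈ sys.D.space m.1 := (ξ.mem m.1).1
  have h2 := generatorM_fst (EG := EG) h m (ξ.toFun m.1)
  exact (congrArg (fun u : E => u ∈ sys.D.space m.1) h2).mpr h1

theorem momentum_eq (m : sys.ConstraintManifold) :
    ξ.momentum h m = (m.2 : CotangentSpace E m.1) (ξ.onQ m.1) :=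
  (sys.oneFormM_apply m _).trans
    (congrArg (m.2 : CotangentSpace E m.1) (generatorM_fst (EG := EG) h m (ξ.toFun m.1)))

theorem differential_momentum_Xnh [FiniteDimensional ℝ E] (m : sys.ConstraintManifold) :
    differential sys.constraintModel (ξ.momentum h) m (sys.Xnh m) =
      -differential sys.constraintModel sys.hamiltonianM m (sys.liftM ξ.onQ m) := by
  have hX := contMDiff_apply_vectorField ξ.onQ_contMDiff
  have h1 : ξ.momentum h = (fun β : CotangentBundle E Q => β.2 (ξ.onQ β.1)) ∘ sys.incl :=
    funext fun m => ξ.momentum_eq h m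
  have h2 : differential sys.constraintModel (ξ.momentum h) m (sys.Xnh m) =
      differential (cotangentModel E) (fun β : CotangentBundle E Q => β.2 (ξ.onQ β.1))
        (sys.incl m) (sys.inclDeriv m (sys.Xnh m)) := by
    rw [h1]
    exact congrArg (fun L : E × (Fin r → ℝ) →L[ℝ] ℝ => L (sys.Xnh m))
      (mfderiv_comp m ((hX _).mdifferentiableAt (by simp))
        ((sys.incl_contMDiff m).mdifferentiableAt (by simp)))
  have hp := sys.projC_spec m (cotangentLift ξ.onQ (sys.incl m))
  have hn := sys.Xnh_spec m
  rw [h2, ← canonicalTwoForm_hamiltonianVectorField]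
  -- X_nh ∈ 𝓒 permits replacing the cotangent lift by its projection; after the swap, the projection
  -- being in 𝓒 permits using the equation of X_nh.
  exact (hp.2 _ hn.1).symm.trans
    ((canonicalTwoForm_swap _ _ _).trans (congrArg Neg.neg (hn.2 _ hp.1)))

theorem lieDerivOneForm_Xnh [FiniteDimensional ℝ E] (m : sys.ConstraintManifold) :
    lieDerivOneForm sys.constraintModel (ξ.onM h) sys.oneFormM m (sys.Xnh m) =
      differential sys.constraintModel (ξ.momentum h) m (sys.Xnh m) := by
  have hJ : ContMDiff sys.constraintModel 𝓘(ℝ, ℝ) ∞ (ξ.momentum h) := by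
    have := (contMDiff_apply_vectorField ξ.onQ_contMDiff).comp sys.incl_contMDiff
    exact this.congr fun m => ξ.momentum_eq h m
  have hn := sys.Xnh_spec m
  refine (lieDerivOneForm_eq (ξ.onM_contMDiff h) (θ := sys.oneFormM)
    (hasFDerivAt_oneFormInChart_pullback sys.incl_contMDiff (fun _ => rfl) m).differentiableAt
    ((hJ m).mdifferentiableAt (by simp)) (sys.Xnh m)).trans ?_
  -- dΘ_𝓜(ξ_𝓜, X_nh) = Ω_𝓜(X_nh, ξ_𝓜) = dH_𝓜(ξ_𝓜) = 0, by ξ_𝓜 ∈ 𝓒 and invariance of H_𝓜.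
  have h1 : extDerivOneForm sys.constraintModel sys.oneFormM m (ξ.onM h m) (sys.Xnh m) = 0 := by
    refine (sys.extDerivOneForm_oneFormM m _ _).trans ?_
    refine (canonicalTwoForm_swap _ _ _).symm.trans ?_
    refine (hn.2 _ (ξ.onM_mem_C h m)).trans ?_
    exact differential_hamiltonianM_generatorM h m _
  rw [h1, zero_add]
  rfl

end SectionGS

end Symmetries

end Nonholonomic

end

theorem proposition3p3
    {E : Type*} [NormedAddCommGroup E] [NormedSpace ℝ E] [FiniteDimensional ℝ E]
    {Q : Type*} [TopologicalSpace Q] [ChartedSpace E Q] [IsManifold 𝓘(ℝ, E) ∞ Q]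
    {EG : Type*} [NormedAddCommGroup EG] [NormedSpace ℝ EG] [FiniteDimensional ℝ EG]
    {G : Type*} [TopologicalSpace G] [ChartedSpace EG G] [Group G] [LieGroup 𝓘(ℝ, EG) ∞ G]
    [MulAction G Q] [ContMDiffSMul 𝓘(ℝ, EG) 𝓘(ℝ, E) ∞ G Q]
    {r : ℕ} (sys : Nonholonomic.System E Q r) (hG : sys.IsSymmetry G) (ξ : Nonholonomic.SectionGS sys EG G) :
    (∀ m : sys.ConstraintManifold,
      Nonholonomic.lieDerivOneForm sys.constraintModel (ξ.onM hG) sys.oneFormM m (sys.Xnh m) =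
        -Nonholonomic.differential sys.constraintModel sys.hamiltonianM m (sys.liftM ξ.onQ m)) ∧
    (sys.IsFirstIntegral (ξ.momentum hG) ↔
      ∀ m : sys.ConstraintManifold,
        Nonholonomic.differential sys.constraintModel sys.hamiltonianM m (sys.liftM ξ.onQ m) = 0) := by
  refine ⟨fun m => (ξ.lieDerivOneForm_Xnh hG m).trans (ξ.differential_momentum_Xnh hG m), ?_⟩
  refine forall_congr' fun m => ?_
  rw [ξ.differential_momentum_Xnh hG m, neg_eq_zero]
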